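/- An information graph $G=(V,E,\alpha)$ is a finite connected simple graph on $n=|V|$ vertices with a sampling probability $\alpha\in(0,1]$. For $u,v\in V$, let $\mathrm{prox}_G(u,v)$ be the probability that $u$ and $v$ are connected when each edge of $G$ is kept independently with probability $\alpha$; the broadcast of $G$ is $\min_{u,v}\mathrm{prox}_G(u,v)$. For an integer $k\ge 0$, let $\beta^*$ be the largest broadcast of a graph $(V,E\cup F,\alpha)$ with $F$ a set of at most $k$ non-edges of $G$. The implied metric of $G$ is $\phi(u,v)=-\log_2\mathrm{prox}_G(u,v)$, and its doubling dimension $d$ is the smallest real number such that, for every $r>0$, every closed ball of radius $r$ is contained in the union of at most $2^d$ closed balls of radius $r/2$. Algorithms are programs for a real RAM (unit-cost addition, subtraction and comparison of natural numbers; unit-cost arithmetic and comparison of real numbers; no conversion of reals to integers) which are given $n$, $k$, $\alpha$, $\varepsilon$, adjacency queries to $G$, and an oracle that returns the exact proximity in $G$ of any two vertices of $G$ in time polynomial in $n$. There are two such algorithms (each a single program for all inputs) which, for every information graph $G=(V,E,\alpha)$, every integer $k\ge 0$ and every real $\varepsilon>0$, halt in time $$\frac{4^k\,k^{2k}\,2^{O(kd)}}{\varepsilon^{O(kd)}}\cdot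 n^{O(1)}$$ (with $0^0=1$, and with $\varepsilon$ replaced by $\min(\varepsilon,1)$ in the denominator), where the hidden constants depend only on the polynomial that bounds the oracle's time, and output a set $F$ of non-edges of $G$ such that (i) for the first algorithm, $|F|\le \max(2k-1,0)$ and the broadcast of $(V,E\cup F,\alpha)$ is at least $\dfrac{(\beta^*)^{2+\varepsilon}\alpha^2}{(1+2k\alpha)^{2+\varepsilon}}$; (ii) for the second algorithm, $|F|\le k$ and the broadcast of $(V,E\cup F,\alpha)$ is at least $\dfrac{(\beta^*)^{2+\varepsilon}\alpha^2}{16^{k+1}}$. -/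

import Mathlib

/-! ## Information graphs -/

namespace InfoGraph

variable {V : Type*} [Fintype V]

open Classical in
/-- Proximity of `u` and `v` in the information graph `(V, E, α)`: the probability that `u` and `v`
are connected when every edge of `G` is kept independently with probability `α`. The sum runs over
the sets `A` of surviving edges. -/
noncomputable def prox (G : SimpleGraph V) (α : ℝ) (u v : V) : ℝ :=
  ∑ A ∈ G.edgeFinset.powerset,
    if (SimpleGraph.fromEdgeSet (A : Set (Sym2 V))).Reachable u v then
      α ^ A.card * (1 - α) ^ (G.edgeFinset \ A).card
    else 0

/-- Broadcast: the minimum pairwise proximity (a vertex has proximity `1` to itself, so that the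
diagonal pairs do not affect the minimum). -/
noncomputable def broadcast (G : SimpleGraph V) (α : ℝ) : ℝ :=
  ⨅ p : V × V, prox G α p.1 p.2

/-- `G + F`. -/
def addEdges (G : SimpleGraph V) (F : Finset (Sym2 V)) : SimpleGraph V :=
  G ⊔ SimpleGraph.fromEdgeSet (F : Set (Sym2 V))

/-- `β*`: the largest broadcast achievable by adding (at most) `k` edges to `G`. -/
noncomputable def optBroadcast (G : SimpleGraph V) (α : ℝ) (k : ℕ) : ℝ :=
  sSup {b : ℝ | ∃ F : Finset (Sym2 V), (F : Set (Sym2 V)) ⊆ Gᶜ.edgeSet ∧ F.card ≤ k ∧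
    b = broadcast (addEdges G F) α}

/-- The implied metric `φ(u, v) = - log₂ prox(u, v)`. -/
noncomputable def impliedDist (G : SimpleGraph V) (α : ℝ) (u v : V) : ℝ :=
  - Real.logb 2 (prox G α u v)

/-- The doubling dimension of the finite space `V` with distance function `ρ`: the smallest real `d`
such that, for every `r > 0`, every (closed) ball of radius `r` is contained in the union of at most
`2 ^ d` balls of radius `r / 2`. -/
noncomputable def doublingDim (ρ : V → V → ℝ) : ℝ :=
  sInf {d : ℝ | ∀ r : ℝ, 0 < r → ∀ x : V, ∃ S : Finset V, (S.card : ℝ) ≤ (2 : ℝ) ^ d ∧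
    {y | ρ x y ≤ r} ⊆ ⋃ c ∈ S, {y | ρ c y ≤ r / 2}}

end InfoGraph

/-! ## A real RAM with a proximity oracle

Memory consists of variables and arrays holding natural numbers, and variables and arrays holding
real numbers. Every program mentions only finitely many variables and arrays; array indices are
natural numbers. Natural numbers can be added, subtracted and compared, real numbers can be added,
subtracted, multiplied, divided and compared, and there is no conversion from reals to naturals.
Every instruction and every test takes one step, except that a query to the proximity oracle takes
a given number `w` of steps. -/

namespace RealRAM

/-- Memory contents. -/
structure State where
  nvar : ℕ → ℕ
  narr : ℕ → ℕ → ℕ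
  rvar : ℕ → ℝ
  rarr : ℕ → ℕ → ℝ

/-- Elementary instructions. -/
inductive Instr
  /-- `x := m` -/
  | nconst (x m : ℕ)
  /-- `x := y + z` -/
  | nadd (x y z : ℕ)
  /-- `x := y - z`, truncated at `0` -/
  | nsub (x y z : ℕ)
  /-- `x := A[i]` -/
  | nload (x A i : ℕ)
  /-- `A[i] := x` -/
  | nstore (A i x : ℕ)
  /-- `x := m`, as a real number -/
  | rconst (x m : ℕ)
  /-- `x := y + z` -/
  | radd (x y z : ℕ)
  /-- `x := y - z` -/
  | rsub (x y z : ℕ)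
  /-- `x := y * z` -/
  | rmul (x y z : ℕ)
  /-- `x := y / z` -/
  | rdiv (x y z : ℕ)
  /-- `x := A[i]`, for a real variable `x` and a real array `A` -/
  | rload (x A i : ℕ)
  /-- `A[i] := x`, for a real variable `x` and a real array `A` -/
  | rstore (A i x : ℕ)
  /-- `x := 1` if the vertices `u` and `v` are adjacent in the input graph, `x := 0` otherwise -/
  | adj (x u v : ℕ)
  /-- `x := ` the proximity of the vertices `u` and `v` in the input graph -/
  | prox (x u v : ℕ)

/-- Tests: `x < y` for natural variables and for real variables. -/
inductive Test
  | nlt (x y : ℕ)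
  | rlt (x y : ℕ)

/-- Programs. -/
inductive Prog
  | skip
  | instr (i : Instr)
  | seq (p q : Prog)
  | branch (b : Test) (p q : Prog)
  | loop (b : Test) (p : Prog)

/-- The answers to adjacency and proximity queries. -/
structure Oracle where
  adj : ℕ → ℕ → ℕ
  prox : ℕ → ℕ → ℝ

/-- The effect of an instruction. -/
noncomputable def Instr.apply (O : Oracle) (s : State) : Instr → State
  | .nconst x m => { s with nvar := Function.update s.nvar x m }
  | .nadd x y z => { s with nvar := Function.update s.nvar x (s.nvar y + s.nvar z) }
  | .nsub x y z => { s with nvar := Function.update s.nvar x (s.nvar y - s.nvar z) }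
  | .nload x A i => { s with nvar := Function.update s.nvar x (s.narr A (s.nvar i)) }
  | .nstore A i x =>
      { s with narr := Function.update s.narr A (Function.update (s.narr A) (s.nvar i) (s.nvar x)) }
  | .rconst x m => { s with rvar := Function.update s.rvar x (m : ℝ) }
  | .radd x y z => { s with rvar := Function.update s.rvar x (s.rvar y + s.rvar z) }
  | .rsub x y z => { s with rvar := Function.update s.rvar x (s.rvar y - s.rvar z) }
  | .rmul x y z => { s with rvar := Function.update s.rvar x (s.rvar y * s.rvar z) }
  | .rdiv x y z => { s with rvar := Function.update s.rvar x (s.rvar y / s.rvar z) }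
  | .rload x A i => { s with rvar := Function.update s.rvar x (s.rarr A (s.nvar i)) }
  | .rstore A i x =>
      { s with rarr := Function.update s.rarr A (Function.update (s.rarr A) (s.nvar i) (s.rvar x)) }
  | .adj x u v => { s with nvar := Function.update s.nvar x (O.adj (s.nvar u) (s.nvar v)) }
  | .prox x u v => { s with rvar := Function.update s.rvar x (O.prox (s.nvar u) (s.nvar v)) }

/-- The number of steps of an instruction, if a proximity query takes `w` steps. -/
def Instr.cost (w : ℕ) : Instr → ℕ
  | .prox _ _ _ => w
  | _ => 1

/-- The outcome of a test. -/
def Test.holds (s : State) : Test → Prop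
  | .nlt x y => s.nvar x < s.nvar y
  | .rlt x y => s.rvar x < s.rvar y

/-- `Exec O w p s s' t`: started in memory `s`, the program `p` halts with memory `s'` after exactly
`t` steps. -/
inductive Exec (O : Oracle) (w : ℕ) : Prog → State → State → ℕ → Prop
  | skip (s : State) : Exec O w .skip s s 1
  | instr (i : Instr) (s : State) : Exec O w (.instr i) s (i.apply O s) (i.cost w)
  | seq {p q : Prog} {s₁ s₂ s₃ : State} {t₁ t₂ : ℕ} :
      Exec O w p s₁ s₂ t₁ → Exec O w q s₂ s₃ t₂ → Exec O w (.seq p q) s₁ s₃ (t₁ + t₂)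
  | branch_true {b : Test} {p q : Prog} {s s' : State} {t : ℕ} :
      b.holds s → Exec O w p s s' t → Exec O w (.branch b p q) s s' (t + 1)
  | branch_false {b : Test} {p q : Prog} {s s' : State} {t : ℕ} :
      ¬ b.holds s → Exec O w q s s' t → Exec O w (.branch b p q) s s' (t + 1)
  | loop_true {b : Test} {p : Prog} {s₁ s₂ s₃ : State} {t₁ t₂ : ℕ} :
      b.holds s₁ → Exec O w p s₁ s₂ t₁ → Exec O w (.loop b p) s₂ s₃ t₂ →
        Exec O w (.loop b p) s₁ s₃ (t₁ + t₂ + 1)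
  | loop_false {b : Test} {p : Prog} {s : State} :
      ¬ b.holds s → Exec O w (.loop b p) s s 1

/-- Initial memory: natural variables `0` and `1` hold `n` and `k`, real variables `0` and `1` hold
`α` and `ε`, everything else is zero. -/
noncomputable def initState (n k : ℕ) (α ε : ℝ) : State where
  nvar := fun x => if x = 0 then n else if x = 1 then k else 0
  narr := fun _ _ => 0
  rvar := fun x => if x = 0 then α else if x = 1 then ε else 0
  rarr := fun _ _ => 0

open Classical in
/-- The oracle that belongs to the information graph `(G, α)` on the vertices `0, …, n - 1`. It
knows nothing about graphs other than `G`, and queries that do not name two vertices return `0`. -/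
noncomputable def graphOracle {n : ℕ} (G : SimpleGraph (Fin n)) (α : ℝ) : Oracle where
  adj := fun u v => if h : u < n ∧ v < n then (if G.Adj ⟨u, h.1⟩ ⟨v, h.2⟩ then 1 else 0) else 0
  prox := fun u v => if h : u < n ∧ v < n then InfoGraph.prox G α ⟨u, h.1⟩ ⟨v, h.2⟩ else 0

/-- The final memory `s` represents the edge set `F`: natural variable `0` holds the length of a list
of pairs of vertices, natural arrays `0` and `1` hold the two vertices of each pair, and `F` is the
set of these pairs. -/
def Represents {n : ℕ} (s : State) (F : Finset (Sym2 (Fin n))) : Prop :=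
  ∃ p : Fin (s.nvar 0) → Fin n × Fin n,
    (∀ i : Fin (s.nvar 0), s.narr 0 (i : ℕ) = ((p i).1 : ℕ) ∧ s.narr 1 (i : ℕ) = ((p i).2 : ℕ)) ∧
    F = Finset.univ.image fun i => s((p i).1, (p i).2)

/-- On input `(G, α)`, `k`, `ε` the program `P` halts after `t` steps with output `F`, where every
query to the proximity oracle takes `n ^ q` steps. -/
def Computes (P : Prog) (q : ℕ) {n : ℕ} (G : SimpleGraph (Fin n)) (α : ℝ) (k : ℕ) (ε : ℝ)
    (F : Finset (Sym2 (Fin n))) (t : ℕ) : Prop :=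
  ∃ s : State, Exec (graphOracle G α) (n ^ q) P (initState n k α ε) s t ∧ Represents s F

end RealRAM

/-- The bound `(4 ^ k * k ^ (2 * k) * 2 ^ O(k * d) / ε ^ O(k * d)) * n ^ O(1)` with hidden constant
`C`. For `ε > 1` the exponent of `ε` is taken to be `0`. -/
noncomputable def timeBound (C n k : ℕ) (ε d : ℝ) : ℝ :=
  (4 : ℝ) ^ k * (k : ℝ) ^ (2 * k) * (2 : ℝ) ^ (C * k * d : ℝ) / (min ε 1) ^ (C * k * d : ℝ) *
    (C * (n : ℝ) ^ C)

/-! In the implied metric `φ`, adding edges reduces to a centre problem: find `m` vertices such that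
every vertex has large proximity to one of them ("coverage"). Joining the centres by a star then
gives broadcast at least `(x * α) ^ 2` for coverage `x`, at a cost of `m - 1` edges. Proximity is
supermultiplicative by Harris' inequality (`prox_mul_prox_le`), so `φ` satisfies the triangle
inequality.

Good centres exist. For `m = 2k`, the endpoints of an optimal `F` work: follow a connection in `G +
F` up to the first edge of `F` and use a union bound (`expect_linked_union_le`,
`exists_centres_two_mul`); the loss is `1 + 2kα`. For `m = k + 1`, start from one vertex and delete
the edges of `F` one at a time, each time adding the endpoint less connected to the current centres.
The van den Berg–Kesten and Harris inequalities bound the loss per edge by a factor `3`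
(`proxTo_insert_le`), and a final union bound over the centres loses `k + 1`
(`exists_centres_succ`).

Good centres can be found. A farthest-first traversal is run for `m` points; by pigeonhole their
coverage `qm` is at least the square of the optimal one. The traversal continues until the coverage
`q` satisfies `qm ≤ q ^ P`, where `P = 2 ^ j` is the first power of two that is at least `4 / ε +
32`. The points of this net are separated at scale `φ`-radius over `P`, so `j + 1` halvings in the
definition of doubling dimension bound its size by `m * 2 ^ (d * (j + 1))` (`IsNet.card_le`).
Rounding optimal centres to the net costs only an exponent `1 + 2 / P` (`rpow_le_of_isNet`), so
trying all `m`-tuples of net points suffices. This takes about `N ^ m ≤ (2k * 2 ^ (d * (j + 1))) ^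
(2k)` rounds, which gives the time bound (`coreTime_le_timeBound`). -/

namespace RealRAM

/-! ### Program logic: weakest preconditions, loops and frames. -/

/-- Started in `s`, the program `p` halts, and `Q` holds of the final memory and the number of
steps. -/
def Runs (O : Oracle) (w : ℕ) (p : Prog) (s : State) (Q : State → ℕ → Prop) : Prop :=
  ∃ s' t, Exec O w p s s' t ∧ Q s' t

section
variable {O : Oracle} {w : ℕ} {p q : Prog} {s : State} {Q Q' : State → ℕ → Prop}

theorem runs_skip : Runs O w .skip s Q ↔ Q s 1 :=
  ⟨fun ⟨_, _, h, hQ⟩ => by cases h; exact hQ, fun h => ⟨_, _, .skip s, h⟩⟩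

theorem runs_instr {i : Instr} : Runs O w (.instr i) s Q ↔ Q (i.apply O s) (i.cost w) :=
  ⟨fun ⟨_, _, h, hQ⟩ => by cases h; exact hQ, fun h => ⟨_, _, .instr i s, h⟩⟩

theorem runs_seq : Runs O w (.seq p q) s Q ↔
    Runs O w p s fun s₁ t₁ => Runs O w q s₁ fun s₂ t₂ => Q s₂ (t₁ + t₂) := by
  constructor
  · rintro ⟨_, _, h, hQ⟩
    cases h with
    | seq h₁ h₂ => exact ⟨_, _, h₁, _, _, h₂, hQ⟩
  · rintro ⟨_, _, h₁, _, _, h₂, hQ⟩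
    exact ⟨_, _, .seq h₁ h₂, hQ⟩

theorem runs_branch {b : Test} : Runs O w (.branch b p q) s Q ↔
    (b.holds s → Runs O w p s fun s' t => Q s' (t + 1)) ∧
    (¬ b.holds s → Runs O w q s fun s' t => Q s' (t + 1)) := by
  constructor
  · rintro ⟨_, _, h, hQ⟩
    cases h with
    | branch_true hb h => exact ⟨fun _ => ⟨_, _, h, hQ⟩, fun h' => absurd hb h'⟩
    | branch_false hb h => exact ⟨fun h' => absurd h' hb, fun _ => ⟨_, _, h, hQ⟩⟩
  · rintro ⟨h₁, h₂⟩
    by_cases hb : b.holds s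
    · obtain ⟨_, _, h, hQ⟩ := h₁ hb
      exact ⟨_, _, .branch_true hb h, hQ⟩
    · obtain ⟨_, _, h, hQ⟩ := h₂ hb
      exact ⟨_, _, .branch_false hb h, hQ⟩

/-- A loop whose body takes at most `T` steps and preserves the indexed invariant `I` halts within
`N * (T + 1) + 1` steps if the index cannot exceed `N`. -/
theorem runs_loop {b : Test} (I : ℕ → State → Prop) (N T : ℕ)
    (hN : ∀ l s, I l s → l ≤ N)
    (hstep : ∀ l s, I l s → b.holds s → Runs O w p s fun s' t => t ≤ T ∧ I (l + 1) s')
    (h0 : I 0 s) :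
    Runs O w (.loop b p) s fun s' t => t ≤ N * (T + 1) + 1 ∧ (∃ l, I l s') ∧ ¬ b.holds s' := by
  suffices H : ∀ (r l : ℕ) (s : State), N - l ≤ r → I l s →
      Runs O w (.loop b p) s fun s' t => t ≤ (N - l) * (T + 1) + 1 ∧ (∃ l, I l s') ∧ ¬ b.holds s' by
    exact H N 0 s (by omega) h0
  intro r
  induction r with
  | zero =>
    intro l s hr hI
    by_cases hb : b.holds s
    · obtain ⟨s', t, -, -, h⟩ := hstep l s hI hb
      have := hN _ _ h
      omega
    · exact ⟨_, _, .loop_false hb, by omega, ⟨l, hI⟩, hb⟩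
  | succ r ih =>
    intro l s hr hI
    by_cases hb : b.holds s
    · obtain ⟨s', t, h1, ht, h⟩ := hstep l s hI hb
      have hle := hN _ _ h
      obtain ⟨s'', t', h2, ht', h'⟩ := ih (l + 1) s' (by omega) h
      refine ⟨_, _, .loop_true hb h1 h2, ?_, h'⟩
      obtain ⟨e, he⟩ : ∃ e, N - l = e + 1 := ⟨N - l - 1, by omega⟩
      have : N - (l + 1) = e := by omega
      rw [this] at ht'
      rw [he, add_mul]
      omega
    · exact ⟨_, _, .loop_false hb, by omega, ⟨l, hI⟩, hb⟩

/-- The natural variables written by an instruction. -/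
def Instr.nwrites : Instr → List ℕ
  | .nconst x _ => [x]
  | .nadd x _ _ => [x]
  | .nsub x _ _ => [x]
  | .nload x _ _ => [x]
  | .adj x _ _ => [x]
  | _ => []

/-- The natural arrays written by an instruction. -/
def Instr.nawrites : Instr → List ℕ
  | .nstore A _ _ => [A]
  | _ => []

/-- The real variables written by an instruction. -/
def Instr.rwrites : Instr → List ℕ
  | .rconst x _ => [x]
  | .radd x _ _ => [x]
  | .rsub x _ _ => [x]
  | .rmul x _ _ => [x]
  | .rdiv x _ _ => [x]
  | .rload x _ _ => [x]
  | .prox x _ _ => [x]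
  | _ => []

/-- Everything that the instructions of a program write, according to `f`. -/
def Prog.writes (f : Instr → List ℕ) : Prog → List ℕ
  | .skip => []
  | .instr i => f i
  | .seq p q => p.writes f ++ q.writes f
  | .branch _ p q => p.writes f ++ q.writes f
  | .loop _ p => p.writes f

/-- `s'` agrees with `s` on all variables and natural arrays that `p` does not write. -/
structure Frame (p : Prog) (s s' : State) : Prop where
  nvar : ∀ x, x ∉ p.writes Instr.nwrites → s'.nvar x = s.nvar x
  narr : ∀ x, x ∉ p.writes Instr.nawrites → s'.narr x = s.narr x
  rvar : ∀ x, x ∉ p.writes Instr.rwrites → s'.rvar x = s.rvar x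

theorem Exec.frame {t : ℕ} {s' : State} (h : Exec O w p s s' t) : Frame p s s' := by
  induction h with
  | skip s => exact ⟨fun _ _ => rfl, fun _ _ => rfl, fun _ _ => rfl⟩
  | instr i s =>
    constructor <;> intro x hx <;> cases i <;>
      simp_all [Prog.writes, Instr.nwrites, Instr.nawrites, Instr.rwrites, Instr.apply]
  | seq _ _ h₁ h₂ =>
    constructor <;> intro x hx <;> simp only [Prog.writes, List.mem_append, not_or] at hx
    · rw [h₂.nvar x hx.2, h₁.nvar x hx.1]
    · rw [h₂.narr x hx.2, h₁.narr x hx.1]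
    · rw [h₂.rvar x hx.2, h₁.rvar x hx.1]
  | branch_true _ _ h =>
    constructor <;> intro x hx <;> simp only [Prog.writes, List.mem_append, not_or] at hx
    exacts [h.nvar x hx.1, h.narr x hx.1, h.rvar x hx.1]
  | branch_false _ _ h =>
    constructor <;> intro x hx <;> simp only [Prog.writes, List.mem_append, not_or] at hx
    exacts [h.nvar x hx.2, h.narr x hx.2, h.rvar x hx.2]
  | loop_true _ _ _ h₁ h₂ =>
    constructor <;> intro x hx
    · rw [h₂.nvar x hx, h₁.nvar x hx]
    · rw [h₂.narr x hx, h₁.narr x hx]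
    · rw [h₂.rvar x hx, h₁.rvar x hx]
  | loop_false _ => exact ⟨fun _ _ => rfl, fun _ _ => rfl, fun _ _ => rfl⟩

/-- The consequence rule, with the frame supplied for free: invariants need only mention what a
program changes, and the rest is recovered from its syntactic write set. -/
theorem Runs.mono (h : Runs O w p s Q) (hQ : ∀ s' t, Q s' t → Frame p s s' → Q' s' t) :
    Runs O w p s Q' := by
  obtain ⟨s', t, h, h'⟩ := h
  exact ⟨s', t, h, hQ s' t h' h.frame⟩

end

/-- `for i < b`, assuming that natural variable `4` holds `1`. -/
def forRange (i b : ℕ) (p : Prog) : Prog :=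
  .seq (.instr (.nconst i 0)) (.loop (.nlt i b) (.seq p (.instr (.nadd i i 4))))

/-- The invariant must be insensitive to the counter (`hI`) because the loop itself resets and
increments it. Each round costs the body, one increment and one test, hence `T + 2`. -/
theorem runs_forRange_eq {O : Oracle} {w : ℕ} {p : Prog} {s : State} {i b : ℕ} (I : ℕ → State → Prop)
    (N T : ℕ) (hi4 : i ≠ 4) (hib : i ≠ b) (h4 : s.nvar 4 = 1) (hb : s.nvar b = N)
    (hp : ∀ x ∈ [i, b, 4], x ∉ p.writes Instr.nwrites)
    (hI : ∀ l s x, I l s → I l { s with nvar := Function.update s.nvar i x })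
    (hstep : ∀ l s, l < N → I l s → s.nvar i = l → s.nvar b = N → s.nvar 4 = 1 →
      Runs O w p s fun s' t => t ≤ T ∧ I (l + 1) s')
    (h0 : I 0 s) :
    Runs O w (forRange i b p) s fun s' t => t ≤ N * (T + 2) + 2 ∧ s'.nvar i = N ∧ I N s' := by
  unfold forRange
  rw [runs_seq, runs_instr]
  refine Runs.mono (runs_loop (fun l s => I l s ∧ s.nvar i = l ∧ s.nvar b = N ∧ s.nvar 4 = 1 ∧ l ≤ N)
    N (T + 1) (fun l s h => h.2.2.2.2) ?_ ?_) ?_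
  · rintro l s ⟨h1, h2, h3, h4, -⟩ hlt
    simp only [Test.holds, h2, h3] at hlt
    rw [runs_seq]
    refine (hstep l s hlt h1 h2 h3 h4).mono ?_
    rintro s' t ⟨ht, hI'⟩ hF
    rw [runs_instr]
    have e1 := hF.nvar i (hp i (by simp))
    have e2 := hF.nvar b (hp b (by simp))
    have e3 := hF.nvar 4 (hp 4 (by simp))
    refine ⟨by simp [Instr.cost]; omega, hI _ _ _ hI', ?_, ?_, ?_, hlt⟩
    · simp [Instr.apply, e1, e3, h2, h4]
    · simp [Instr.apply, e2, h3, Function.update_of_ne hib.symm]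
    · simp [Instr.apply, e3, h4, Function.update_of_ne hi4.symm]
  · refine ⟨hI _ _ _ h0, ?_, ?_, ?_, by omega⟩
    · simp [Instr.apply]
    · simp [Instr.apply, hb, Function.update_of_ne hib.symm]
    · simp [Instr.apply, h4, Function.update_of_ne hi4.symm]
  · rintro s' t ⟨ht, ⟨l, h1, h2, h3, -, h5⟩, h6⟩ -
    simp only [Test.holds, h2, h3] at h6
    obtain rfl : l = N := by omega
    refine ⟨?_, h2, h1⟩
    simp only [Instr.cost]
    have : l * (T + 1 + 1) = l * (T + 2) := rfl
    omega

theorem runs_forRange {O : Oracle} {w : ℕ} {p : Prog} {s : State} {i b : ℕ} (I : ℕ → State → Prop)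
    (N T : ℕ) (hi4 : i ≠ 4) (hib : i ≠ b) (h4 : s.nvar 4 = 1) (hb : s.nvar b = N)
    (hp : ∀ x ∈ [i, b, 4], x ∉ p.writes Instr.nwrites)
    (hI : ∀ l s x, I l s → I l { s with nvar := Function.update s.nvar i x })
    (hstep : ∀ l s, l < N → I l s → s.nvar i = l → s.nvar b = N → s.nvar 4 = 1 →
      Runs O w p s fun s' t => t ≤ T ∧ I (l + 1) s')
    (h0 : I 0 s) :
    Runs O w (forRange i b p) s fun s' t => t ≤ N * (T + 2) + 2 ∧ I N s' :=
  (runs_forRange_eq I N T hi4 hib h4 hb hp hI hstep h0).mono fun _ _ h _ => ⟨h.1, h.2.2⟩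

end RealRAM
-- Subroutines: coverage, powers, output of a star, enumeration of tuples.
namespace RealRAM

infixr:60 " ;; " => Prog.seq

/-- `q` is `min_{v < n} max_{i < L} pr v (A i)`, or `1`, and `v` attains the minimum. -/
structure IsCoverage (pr : ℕ → ℕ → ℝ) (n : ℕ) (A : ℕ → ℕ) (L : ℕ) (q : ℝ) (v : ℕ) : Prop where
  lt : v < n
  le : ∀ i < L, pr v (A i) ≤ q
  cover : 0 < L → ∀ u < n, ∃ i < L, q ≤ pr u (A i)

/-- Computes the coverage of the first `nvar len` entries of the array `arr` into `rvar 2`, and a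
vertex of least proximity to them into `nvar 9`. -/
def cov (arr len : ℕ) : Prog :=
  .instr (.rconst 2 1) ;; .instr (.nconst 9 0) ;;
  forRange 6 2 (
    .instr (.rconst 3 0) ;;
    forRange 7 len (
      .instr (.nload 8 arr 7) ;; .instr (.prox 4 6 8) ;;
      .branch (.rlt 3 4) (.instr (.radd 3 4 11)) .skip) ;;
    .branch (.rlt 3 2) (.instr (.radd 2 3 11) ;; .instr (.nadd 9 6 16)) .skip)

/-- `rvar 5 := rvar 2 ^ P` for the first power of two `P` that is at least `rvar 7`. -/
def pow : Prog :=
  .instr (.radd 5 2 11) ;; .instr (.rconst 6 1) ;;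
  .loop (.rlt 6 7) (.instr (.rmul 5 5 5) ;; .instr (.radd 6 6 6))

/-- Adds the pair `(nvar 14, nvar 12)` to the output. -/
def push : Prog :=
  .instr (.nstore 0 0 14) ;; .instr (.nstore 1 0 12) ;; .instr (.nadd 0 0 4)

/-- Outputs the star on the first `nvar 3` entries of array `3`, without loops and edges of the
graph. -/
def emit : Prog :=
  .instr (.nconst 0 0) ;; .instr (.nload 14 3 16) ;;
  forRange 11 3 (
    .instr (.nload 12 3 11) ;; .instr (.adj 15 14 12) ;;
    .branch (.nlt 15 4)
      (.branch (.nlt 12 14) push (.branch (.nlt 14 12) push .skip)) .skip)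

/-- Adds one to the number in base `nvar 5` whose first `nvar 3` digits are in array `4`; `nvar 10`
is the carry. -/
def odometer : Prog :=
  .instr (.nconst 10 1) ;;
  forRange 11 3 (
    .branch (.nlt 16 10)
      (.instr (.nload 12 4 11) ;; .instr (.nadd 12 12 4) ;;
        .branch (.nlt 12 5) (.instr (.nstore 4 11 12) ;; .instr (.nconst 10 0))
          (.instr (.nstore 4 11 16)))
      .skip)

/-- Copies the entries of array `2` whose indices are in array `4` to array `3`. -/
def fill : Prog :=
  forRange 11 3 (.instr (.nload 12 4 11) ;; .instr (.nload 13 2 12) ;; .instr (.nstore 3 11 13))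

/-- The bounds on the answers to queries that the program relies on. -/
structure Oracle.Bounded (O : Oracle) : Prop where
  nonneg : ∀ u v, 0 ≤ O.prox u v
  le_one : ∀ u v, O.prox u v ≤ 1

/-- The running maximum starts at `0` and the running minimum at `1`. Both defaults are harmless
because all answers of the oracle lie in `[0, 1]`. -/
theorem runs_cov {O : Oracle} (hO : O.Bounded) {w arr len n L : ℕ} {s : State} (hn : 0 < n)
    (h2 : s.nvar 2 = n) (h4 : s.nvar 4 = 1) (h16 : s.nvar 16 = 0) (h11 : s.rvar 11 = 0)
    (hL : s.nvar len = L) (hlen : len ∉ [4, 6, 7, 8, 9]) :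
    Runs O w (cov arr len) s fun s' t => t ≤ n * (L * (w + 5) + 10) + 4 ∧
      IsCoverage O.prox n (s.narr arr) L (s'.rvar 2) (s'.nvar 9) := by
  simp only [List.mem_cons, List.not_mem_nil, or_false, not_or] at hlen
  obtain ⟨l4, l6, l7, l8, l9⟩ := hlen
  set A := s.narr arr with hA
  unfold cov
  simp only [runs_seq, runs_instr]
  refine Runs.mono (runs_forRange (fun v s' => s'.narr arr = A ∧ s'.nvar 16 = 0 ∧ s'.rvar 11 = 0 ∧
    s'.nvar len = L ∧ s'.nvar 9 < n ∧ (∀ i < L, O.prox (s'.nvar 9) (A i) ≤ s'.rvar 2) ∧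
    (0 < L → ∀ u < v, ∃ i < L, s'.rvar 2 ≤ O.prox u (A i))) n (L * (w + 5) + 8)
    (by decide) (by decide) ?_ ?_ ?_ ?_ ?_ ?_) ?_
  · simp [Instr.apply, h4]
  · simp [Instr.apply, h2]
  · simp [Prog.writes, Instr.nwrites, forRange]
  · rintro v s x ⟨h1, h2, h3, h4, h5⟩
    refine ⟨h1, ?_, h3, ?_, ?_⟩
    · simpa using h2
    · simpa [Function.update_of_ne l6] using h4
    · simpa using h5
  · rintro v s hv ⟨h1, h2, h3, h4, h5, h6, h7⟩ hv' hb hone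
    simp only [runs_seq, runs_instr]
    refine Runs.mono (runs_forRange (fun i s' => s'.narr arr = A ∧ s'.nvar 6 = v ∧ s'.rvar 11 = 0 ∧
      (∀ i' < i, O.prox v (A i') ≤ s'.rvar 3) ∧
      (s'.rvar 3 = 0 ∨ ∃ i' < i, s'.rvar 3 ≤ O.prox v (A i'))) L (w + 3)
      (by decide) (Ne.symm l7) ?_ ?_ ?_ ?_ ?_ ?_) ?_
    · simp [Instr.apply, hone]
    · simp [Instr.apply, h4]
    · simp [Prog.writes, Instr.nwrites, l8]
    · rintro i s x ⟨g1, g2, g3⟩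
      exact ⟨g1, by simpa using g2, g3⟩
    · rintro i s hi ⟨g1, g2, g3, g4, g5⟩ gi gb gone
      simp only [runs_seq, runs_instr, runs_branch, runs_skip, Test.holds, Instr.apply, Instr.cost]
      simp only [Function.update_self, ne_eq, Nat.reduceEqDiff,
        not_false_eq_true, Function.update_of_ne, g1, g2, g3, gi, add_zero, not_lt]
      refine ⟨fun hlt => ⟨by omega, by trivial, by trivial, by trivial, ?_, ?_⟩,
        fun hle => ⟨by omega, by trivial, by trivial, by trivial, ?_, ?_⟩⟩
      · intro i' hi'
        rcases Nat.lt_succ_iff_lt_or_eq.1 hi' with h | rfl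
        · exact (g4 i' h).trans hlt.le
        · exact le_rfl
      · exact Or.inr ⟨i, by omega, le_rfl⟩
      · intro i' hi'
        rcases Nat.lt_succ_iff_lt_or_eq.1 hi' with h | rfl
        · exact g4 i' h
        · exact hle
      · exact g5.imp_right fun ⟨i', h, h'⟩ => ⟨i', by omega, h'⟩
    · refine ⟨h1, by simpa [Instr.apply] using hv', by simpa [Instr.apply] using h3, ?_, Or.inl ?_⟩
      · intro i' hi'; omega
      · simp [Instr.apply]
    · rintro s' t ⟨ht, g1, g2, g3, g4, g5⟩ hF
      have e16 : s'.nvar 16 = 0 := by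
        rw [hF.nvar 16 (by simp [forRange, Prog.writes, Instr.nwrites])]; simpa [Instr.apply] using h2
      have elen : s'.nvar len = L := by
        rw [hF.nvar len (by simp [forRange, Prog.writes, Instr.nwrites, l7, l8])]
        simpa [Instr.apply] using h4
      have e9 : s'.nvar 9 = s.nvar 9 := by
        rw [hF.nvar 9 (by simp [forRange, Prog.writes, Instr.nwrites])]; simp [Instr.apply]
      have e2 : s'.rvar 2 = s.rvar 2 := by
        rw [hF.rvar 2 (by simp [forRange, Prog.writes, Instr.rwrites])]; simp [Instr.apply]
      simp only [runs_seq, runs_instr, runs_branch, runs_skip, Test.holds, Instr.apply, Instr.cost]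
      simp only [Function.update_self, ne_eq, Nat.reduceEqDiff,
        not_false_eq_true, Function.update_of_ne, g1, g2, g3, e16, e9, e2, add_zero, not_lt, l9, elen]
      have hcov : 0 < L → ∃ i < L, s'.rvar 3 ≤ O.prox v (A i) := fun hL => by
        rcases g5 with h | h
        · exact ⟨0, hL, h ▸ hO.nonneg _ _⟩
        · exact h
      have e : L * (w + 5) = L * (w + 3 + 2) := rfl
      refine ⟨fun hlt => ⟨by omega, by trivial, by trivial, by trivial, by trivial, hv, g4, ?_⟩,
        fun hle => ⟨by omega, by trivial, by trivial, by trivial, by trivial, h5, h6, ?_⟩⟩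
      · intro hL u hu
        rcases Nat.lt_succ_iff_lt_or_eq.1 hu with h | rfl
        · obtain ⟨i, hi, hi'⟩ := h7 hL u h
          exact ⟨i, hi, hlt.le.trans hi'⟩
        · exact hcov hL
      · intro hL u hu
        rcases Nat.lt_succ_iff_lt_or_eq.1 hu with h | rfl
        · exact h7 hL u h
        · obtain ⟨i, hi, hi'⟩ := hcov hL
          exact ⟨i, hi, hle.trans hi'⟩
  · simp [Instr.apply, h16, h11, hn, Function.update_of_ne l9, hL, hO.le_one, hA]
  · rintro s' t ⟨ht, h1, h2, h3, h4, h5, h6, h7⟩ -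
    simp only [Instr.cost]
    refine ⟨?_, h5, h6, h7⟩
    have : n * (L * (w + 5) + 8 + 2) = n * (L * (w + 5) + 10) := rfl
    omega

/-- Repeated squaring. The exponent is tracked as a real number and compared with the threshold, so
neither a logarithm nor a conversion to integers is needed. -/
theorem runs_pow {O : Oracle} {w j : ℕ} {s : State} {q thr : ℝ} (h11 : s.rvar 11 = 0)
    (h2 : s.rvar 2 = q) (h7 : s.rvar 7 = thr) (hj : thr ≤ 2 ^ j) (hj' : ∀ i < j, (2 : ℝ) ^ i < thr) :
    Runs O w pow s fun s' t => t ≤ j * 3 + 3 ∧ s'.rvar 5 = q ^ 2 ^ j := by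
  unfold pow
  simp only [runs_seq, runs_instr]
  refine Runs.mono (runs_loop (fun i s' => i ≤ j ∧ s'.rvar 7 = thr ∧ s'.rvar 6 = 2 ^ i ∧
    s'.rvar 5 = q ^ 2 ^ i) j 2 (fun l s h => h.1) ?_ ?_) ?_
  · rintro l s ⟨h1, h2, h3, h4⟩ hlt
    simp only [Test.holds, h2, h3] at hlt
    have : l < j := by
      by_contra hle
      exact absurd hlt (not_lt.2 (hj.trans (pow_le_pow_right₀ (by norm_num) (not_lt.1 hle))))
    simp only [runs_seq, runs_instr, Instr.apply, Instr.cost]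
    simp only [Function.update_self, ne_eq, Nat.reduceEqDiff,
        not_false_eq_true, Function.update_of_ne, h2, h3, h4]
    refine ⟨by omega, this, by trivial, by ring, ?_⟩
    rw [pow_succ 2 l, pow_mul, sq]
  · simp [Instr.apply, h11, h2, h7]
  · rintro s' t ⟨ht, ⟨l, h1, h2, h3, h4⟩, h5⟩ -
    simp only [Test.holds, h2, h3] at h5
    have : l = j := by
      by_contra hne
      exact h5 (hj' l (by omega))
    subst this
    exact ⟨by simp only [Instr.cost]; omega, h4⟩

/-- The arrays `o₀`, `o₁` list, up to position `len`, the edges of the star on `B 0, …, B (m - 1)`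
without loops and edges of the graph. -/
structure IsStar (adj : ℕ → ℕ → ℕ) (B : ℕ → ℕ) (m len : ℕ) (o₀ o₁ : ℕ → ℕ) : Prop where
  len_le : len ≤ m - 1
  fst_eq : ∀ l < len, o₀ l = B 0
  snd_eq : ∀ l < len, ∃ i < m, o₁ l = B i ∧ B i ≠ B 0 ∧ adj (B 0) (B i) = 0
  mem : ∀ i < m, B i ≠ B 0 → adj (B 0) (B i) = 0 → ∃ l < len, o₁ l = B i

theorem IsStar.skip {adj : ℕ → ℕ → ℕ} {B : ℕ → ℕ} {m len : ℕ} {o₀ o₁ : ℕ → ℕ}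
    (h : IsStar adj B m len o₀ o₁) (hB : B m ≠ B 0 → adj (B 0) (B m) ≠ 0) :
    IsStar adj B (m + 1) len o₀ o₁ where
  len_le := by have := h.len_le; omega
  fst_eq := h.fst_eq
  snd_eq l hl := by
    obtain ⟨i, hi, h'⟩ := h.snd_eq l hl
    exact ⟨i, by omega, h'⟩
  mem i hi h₁ h₂ := by
    rcases Nat.lt_succ_iff_lt_or_eq.1 hi with hi | rfl
    · exact h.mem i hi h₁ h₂
    · exact absurd h₂ (hB h₁)

theorem IsStar.push {adj : ℕ → ℕ → ℕ} {B : ℕ → ℕ} {m len : ℕ} {o₀ o₁ : ℕ → ℕ}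
    (h : IsStar adj B m len o₀ o₁) (hB : B m ≠ B 0) (hB' : adj (B 0) (B m) = 0) :
    IsStar adj B (m + 1) (len + 1) (Function.update o₀ len (B 0)) (Function.update o₁ len (B m)) where
  len_le := by
    have := h.len_le
    -- Index `0` is the hub itself and is never pushed; this is why the star has at most `m - 1`
    -- edges.
    have : m ≠ 0 := by rintro rfl; exact hB rfl
    omega
  fst_eq l hl := by
    rcases Nat.lt_succ_iff_lt_or_eq.1 hl with hl | rfl
    · rw [Function.update_of_ne hl.ne, h.fst_eq l hl]
    · simp
  snd_eq l hl := by
    rcases Nat.lt_succ_iff_lt_or_eq.1 hl with hl | rfl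
    · obtain ⟨i, hi, h'⟩ := h.snd_eq l hl
      rw [Function.update_of_ne hl.ne]
      exact ⟨i, by omega, h'⟩
    · exact ⟨m, by omega, by simp, hB, hB'⟩
  mem i hi h₁ h₂ := by
    rcases Nat.lt_succ_iff_lt_or_eq.1 hi with hi | rfl
    · obtain ⟨l, hl, h'⟩ := h.mem i hi h₁ h₂
      exact ⟨l, by omega, by rw [Function.update_of_ne hl.ne, h']⟩
    · exact ⟨len, by omega, by simp⟩

theorem runs_emit {O : Oracle} {w m : ℕ} {s : State} (h3 : s.nvar 3 = m)
    (h4 : s.nvar 4 = 1) (h16 : s.nvar 16 = 0) :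
    Runs O w emit s fun s' t => t ≤ m * 10 + 4 ∧
      IsStar O.adj (s.narr 3) m (s'.nvar 0) (s'.narr 0) (s'.narr 1) := by
  set B := s.narr 3 with hB
  unfold emit
  simp only [runs_seq, runs_instr]
  refine Runs.mono (runs_forRange (fun i s' => s'.narr 3 = B ∧ s'.nvar 14 = B 0 ∧
    IsStar O.adj B i (s'.nvar 0) (s'.narr 0) (s'.narr 1)) m 8
    (by decide) (by decide) ?_ ?_ ?_ ?_ ?_ ?_) ?_
  · simp [Instr.apply, h4]
  · simp [Instr.apply, h3]
  · simp [Prog.writes, Instr.nwrites, push]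
  · rintro v s x ⟨h1, h2, h3⟩
    exact ⟨h1, by simpa using h2, by simpa using h3⟩
  · rintro i s hi ⟨g1, g2, g3⟩ gi gb gone
    simp only [push, runs_seq, runs_instr, runs_branch, runs_skip, Test.holds, Instr.apply,
      Instr.cost]
    simp [g1, g2, gi, gone, Function.update_of_ne]
    -- The two strict comparisons together implement the test `≠`.
    refine ⟨fun h0 => ⟨fun hlt => g3.push hlt.ne h0, fun hle => ⟨fun hlt => g3.push hlt.ne' h0,
      fun hle' => g3.skip fun h => absurd (le_antisymm hle' hle) h⟩⟩, fun h0 => g3.skip fun _ => h0⟩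
  · refine ⟨by simp [Instr.apply, hB], by simp [Instr.apply, h16, hB], ?_⟩
    simp only [Instr.apply]
    constructor <;> simp
  · rintro s' t ⟨ht, h1, h2, h3⟩ -
    exact ⟨by simp only [Instr.cost]; omega, h3⟩

theorem runs_fill {O : Oracle} {w m : ℕ} {s : State} (h3 : s.nvar 3 = m) (h4 : s.nvar 4 = 1) :
    Runs O w fill s fun s' t => t ≤ m * 5 + 2 ∧
      ∀ i < m, s'.narr 3 i = s.narr 2 (s.narr 4 i) := by
  set A := s.narr 2 with hA
  set D := s.narr 4 with hD
  unfold fill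
  refine Runs.mono (runs_forRange (fun i s' => s'.narr 2 = A ∧ s'.narr 4 = D ∧
    ∀ i' < i, s'.narr 3 i' = A (D i')) m 3
    (by decide) (by decide) h4 h3 ?_ ?_ ?_ ?_) ?_
  · simp [Prog.writes, Instr.nwrites]
  · rintro v s x ⟨h1, h2, h3⟩
    exact ⟨h1, h2, h3⟩
  · rintro i s hi ⟨g1, g2, g3⟩ gi gb gone
    simp only [runs_seq, runs_instr, Instr.apply, Instr.cost]
    simp [g1, g2, gi, Function.update_of_ne]
    intro i' hi'
    rcases hi'.lt_or_eq with h | rfl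
    · rw [Function.update_of_ne h.ne, g3 i' h]
    · simp
  · simp [hA, hD]
  · rintro s' t ⟨ht, h1, h2, h3⟩ -
    exact ⟨by omega, h3⟩

/-- Digit `i` in base `N` changes exactly when a carry reaches it, that is, when `N ^ i ∣ t + 1`. -/
theorem succ_div_pow_mod {N t i : ℕ} (hN : 0 < N) : (t + 1) / N ^ i % N =
    if N ^ i ∣ t + 1 then if t / N ^ i % N + 1 < N then t / N ^ i % N + 1 else 0
    else t / N ^ i % N := by
  rw [Nat.succ_div]
  split_ifs with h1 h2
  · rw [Nat.add_mod, Nat.mod_eq_of_lt (a := _ + _)]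
    · rw [Nat.mod_eq_of_lt (a := 1) (by omega)]
    · rw [Nat.mod_eq_of_lt (a := 1) (by omega)]; exact h2
  · have hlt := Nat.mod_lt (t / N ^ i) hN
    have : t / N ^ i % N + 1 = N := by omega
    rw [← Nat.mod_add_mod, this, Nat.mod_self]
  · simp

/-- A carry leaves position `i` exactly when one arrives there and the digit is already `N - 1`. -/
theorem pow_succ_dvd_succ_iff {N t i : ℕ} (hN : 0 < N) :
    N ^ (i + 1) ∣ t + 1 ↔ N ^ i ∣ t + 1 ∧ ¬ t / N ^ i % N + 1 < N := by
  have key := succ_div_pow_mod (t := t) (i := i) hN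
  rw [pow_succ]
  constructor
  · intro h
    have h1 : N ^ i ∣ t + 1 := (Dvd.intro _ rfl).trans h
    refine ⟨h1, fun h2 => ?_⟩
    rw [if_pos h1, if_pos h2] at key
    obtain ⟨c, hc⟩ := h
    rw [hc, mul_assoc, Nat.mul_div_cancel_left _ (by positivity), Nat.mul_mod_right] at key
    omega
  · rintro ⟨h1, h2⟩
    rw [if_pos h1, if_neg h2] at key
    obtain ⟨c, hc⟩ := h1
    rw [hc, Nat.mul_div_cancel_left _ (by positivity)] at key
    rw [hc]
    exact Nat.mul_dvd_mul_left _ (Nat.dvd_of_mod_eq_zero key)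

/-- Before position `i` is treated, the digits below `i` are those of `c + 1`, the others still
those of `c`, and the carry says whether `N ^ i ∣ c + 1`. The final carry signals that all tuples
have been enumerated. -/
theorem runs_odometer {O : Oracle} {w m N c : ℕ} {s : State} (hN : 0 < N) (h3 : s.nvar 3 = m)
    (h4 : s.nvar 4 = 1) (h5 : s.nvar 5 = N) (h16 : s.nvar 16 = 0)
    (hD : ∀ i < m, s.narr 4 i = c / N ^ i % N) :
    Runs O w odometer s fun s' t => t ≤ m * 10 + 3 ∧
      (∀ i < m, s'.narr 4 i = (c + 1) / N ^ i % N) ∧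
      s'.nvar 10 = if N ^ m ∣ c + 1 then 1 else 0 := by
  unfold odometer
  simp only [runs_seq, runs_instr]
  refine Runs.mono (runs_forRange (fun i s' => s'.nvar 16 = 0 ∧ s'.nvar 5 = N ∧
    s'.nvar 10 = (if N ^ i ∣ c + 1 then 1 else 0) ∧
    ∀ l < m, s'.narr 4 l = if l < i then (c + 1) / N ^ l % N else c / N ^ l % N) m 8
    (by decide) (by decide) ?_ ?_ ?_ ?_ ?_ ?_) ?_
  · simp [Instr.apply, h4]
  · simp [Instr.apply, h3]
  · simp [Prog.writes, Instr.nwrites]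
  · rintro v s x ⟨h1, h2, h3, h4⟩
    exact ⟨by simpa using h1, by simpa using h2, by simpa using h3, h4⟩
  · rintro i s hi ⟨g1, g2, g3, g4⟩ gi gb gone
    have g4i : s.narr 4 i = c / N ^ i % N := by rw [g4 i hi, if_neg (lt_irrefl _)]
    simp only [runs_seq, runs_instr, runs_branch, runs_skip, Test.holds, Instr.apply, Instr.cost]
    have hs := succ_div_pow_mod (t := c) (i := i) hN
    have hp := pow_succ_dvd_succ_iff (t := c) (i := i) hN
    have old : ∀ l < m, l ≠ i → s.narr 4 l =
        if l ≤ i then (c + 1) / N ^ l % N else c / N ^ l % N := by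
      intro l hl hne
      rw [g4 l hl]
      by_cases h : l < i
      · rw [if_pos h, if_pos (by omega)]
      · rw [if_neg h, if_neg (by omega)]
    simp [g1, g2, gi, gone, g4i, Function.update_of_ne]
    refine ⟨fun hc => ⟨fun hlt => ⟨?_, ?_⟩, fun hle => ⟨?_, ?_⟩⟩, fun hc => ⟨?_, ?_⟩⟩
    · rw [hp]; exact fun h => h.2 hlt
    · intro l hl
      by_cases hli : l = i
      · subst hli
        rw [Function.update_self, if_pos (by omega), hs, if_pos, if_pos hlt]
        by_contra hd
        simp [g3, hd] at hc
      · rw [Function.update_of_ne hli]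
        exact old l hl hli
    · have hd : N ^ i ∣ c + 1 := by
        by_contra hd
        simp [g3, hd] at hc
      rw [if_pos (hp.2 ⟨hd, not_lt.2 hle⟩), g3, if_pos hd]
    · intro l hl
      by_cases hli : l = i
      · subst hli
        rw [Function.update_self, if_pos (by omega), hs, if_pos, if_neg (not_lt.2 hle)]
        by_contra hd
        simp [g3, hd] at hc
      · rw [Function.update_of_ne hli]
        exact old l hl hli
    · have hd : ¬ N ^ i ∣ c + 1 := by
        intro hd
        simp [g3, hd] at hc
      rw [if_neg fun h => hd (hp.1 h).1, hc]
    · intro l hl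
      by_cases hli : l = i
      · subst hli
        rw [if_pos (by omega), hs, if_neg, g4i]
        intro hd
        simp [g3, hd] at hc
      · exact old l hl hli
  · refine ⟨by simp [Instr.apply, h16], by simp [Instr.apply, h5], by simp [Instr.apply], ?_⟩
    intro l hl
    simp [Instr.apply, hD l hl]
  · rintro s' t ⟨ht, h1, h2, h3, h4⟩ -
    refine ⟨by simp only [Instr.cost]; omega, ?_, h3⟩
    intro i hi
    rw [h4 i hi, if_pos hi]

end RealRAM
-- Farthest-first traversal, search over tuples, and the whole program.
namespace RealRAM

/-- The entries of `A` up to position `L` have proximity at most `q` to each other. -/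
def Spread (pr : ℕ → ℕ → ℝ) (A : ℕ → ℕ) (L : ℕ) (q : ℝ) : Prop :=
  ∀ b < L, ∀ a < b, pr (A b) (A a) ≤ q

section
variable {pr : ℕ → ℕ → ℝ} {n L : ℕ} {A A' : ℕ → ℕ} {q q' : ℝ} {v v' : ℕ}

theorem IsCoverage.congr (h : IsCoverage pr n A L q v) (hA : ∀ i < L, A' i = A i) :
    IsCoverage pr n A' L q v where
  lt := h.lt
  le i hi := by rw [hA i hi]; exact h.le i hi
  cover hL u hu := by
    obtain ⟨i, hi, h'⟩ := h.cover hL u hu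
    exact ⟨i, hi, by rwa [hA i hi]⟩

theorem Spread.congr (h : Spread pr A L q) (hA : ∀ i < L, A' i = A i) : Spread pr A' L q := by
  intro b hb a ha
  rw [hA b hb, hA a (ha.trans hb)]
  exact h b hb a ha

theorem Spread.mono (h : Spread pr A L q) (hq : q ≤ q') : Spread pr A L q' :=
  fun b hb a ha => (h b hb a ha).trans hq

theorem IsCoverage.mono (h : IsCoverage pr n A L q v) (hL : 0 < L)
    (h' : IsCoverage pr n (Function.update A L v) (L + 1) q' v') : q ≤ q' := by
  obtain ⟨i, hi, hq⟩ := h.cover hL v' h'.lt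
  have := h'.le i (by omega)
  rw [Function.update_of_ne hi.ne] at this
  exact hq.trans this

theorem Spread.snoc (hs : Spread pr A L q) (h : IsCoverage pr n A L q v) :
    Spread pr (Function.update A L v) (L + 1) q := by
  intro b hb a ha
  rcases Nat.lt_succ_iff_lt_or_eq.1 hb with hb | rfl
  · rw [Function.update_of_ne hb.ne, Function.update_of_ne (ha.trans hb).ne]
    exact hs b hb a ha
  · rw [Function.update_self, Function.update_of_ne ha.ne]
    exact h.le a ha

/-- The invariant of the farthest-first traversal. The new point has proximity at most the old
coverage to all earlier points, and coverage only grows. For `L = 0` nothing relates `q` and `q'`,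
but one point is vacuously spread. -/
theorem Spread.step (hs : Spread pr A L q) (h : IsCoverage pr n A L q v)
    (h' : IsCoverage pr n (Function.update A L v) (L + 1) q' v') :
    Spread pr (Function.update A L v) (L + 1) q' := by
  rcases Nat.eq_zero_or_pos L with rfl | hL
  · intro b hb a ha; omega
  · exact (hs.snoc h).mono (h.mono hL h')

end

/-- The state of a farthest-first traversal with `N` points that goes on after `m` points as long as
the coverage `q` satisfies `q ^ P < qm`, where `qm` is the coverage of the first `m` points. -/
structure IsNet (pr : ℕ → ℕ → ℝ) (n m P : ℕ) (A : ℕ → ℕ) (N : ℕ) (qm : ℝ) : Prop where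
  le : m ≤ N
  lt : ∀ i < N, A i < n
  coverage : ∃ v, IsCoverage pr n A m qm v
  spread : Spread pr A m qm
  sep : N = m ∨ ∃ q, q ^ P < qm ∧ Spread pr A N q

/-- The values of the variables that stay fixed. -/
structure Env (n m : ℕ) (thr : ℝ) (s : State) : Prop where
  n2 : s.nvar 2 = n
  n3 : s.nvar 3 = m
  n4 : s.nvar 4 = 1
  n16 : s.nvar 16 = 0
  r7 : s.rvar 7 = thr
  r11 : s.rvar 11 = 0

theorem Env.frame {n m : ℕ} {thr : ℝ} {p : Prog} {s s' : State} (h : Env n m thr s)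
    (hF : Frame p s s') (h₁ : ∀ x ∈ [2, 3, 4, 16], x ∉ p.writes Instr.nwrites)
    (h₂ : ∀ x ∈ [7, 11], x ∉ p.writes Instr.rwrites) : Env n m thr s' where
  n2 := by rw [hF.nvar 2 (h₁ 2 (by simp)), h.n2]
  n3 := by rw [hF.nvar 3 (h₁ 3 (by simp)), h.n3]
  n4 := by rw [hF.nvar 4 (h₁ 4 (by simp)), h.n4]
  n16 := by rw [hF.nvar 16 (h₁ 16 (by simp)), h.n16]
  r7 := by rw [hF.rvar 7 (h₂ 7 (by simp)), h.r7]
  r11 := by rw [hF.rvar 11 (h₂ 11 (by simp)), h.r11]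

/-- The first `nvar 3` points of the farthest-first traversal, in array `2`. -/
def traverse : Prog := forRange 5 3 (cov 2 5 ;; .instr (.nstore 2 5 9))

/-- Records the coverage of the first points. -/
def measure : Prog := cov 2 5 ;; .instr (.radd 8 2 11) ;; pow

/-- One more point of the traversal. -/
def extend : Prog :=
  .instr (.nstore 2 5 9) ;; .instr (.nadd 5 5 4) ;; cov 2 5 ;; pow

/-- Evaluates the tuple in array `4`, and moves to the next one. -/
def tryTuple : Prog :=
  fill ;; cov 3 3 ;; .branch (.rlt 9 2) (.instr (.radd 9 2 11) ;; emit) .skip ;; odometer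

/-- The main part of the program. -/
def core : Prog :=
  traverse ;; measure ;; .loop (.rlt 5 8) extend ;; .loop (.nlt 10 4) tryTuple

/-- A bound on the number of steps of `cov`. -/
def covTime (n w L : ℕ) : ℕ := n * (L * (w + 5) + 10) + 4

theorem covTime_mono {n w L L' : ℕ} (h : L ≤ L') : covTime n w L ≤ covTime n w L' := by
  unfold covTime; gcongr

theorem runs_traverse {O : Oracle} (hO : O.Bounded) {w n m : ℕ} {thr : ℝ} {s : State} (hn : 0 < n)
    (hs : Env n m thr s) :
    Runs O w traverse s fun s' t => t ≤ m * (covTime n w m + 3) + 2 ∧ s'.nvar 5 = m ∧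
      (∀ i < m, s'.narr 2 i < n) ∧
      ∀ q v, IsCoverage O.prox n (s'.narr 2) m q v → Spread O.prox (s'.narr 2) m q := by
  unfold traverse
  refine Runs.mono
    (runs_forRange_eq (fun l s' => Env n m thr s' ∧ l ≤ m ∧ (∀ i < l, s'.narr 2 i < n) ∧
      ∀ q v, IsCoverage O.prox n (s'.narr 2) l q v → Spread O.prox (s'.narr 2) l q)
      m (covTime n w m + 1) (by decide) (by decide) hs.n4 hs.n3 (by decide) ?_ ?_ ?_) ?_
  · rintro l s x ⟨h1, h2⟩
    exact ⟨⟨by simpa using h1.n2, by simpa using h1.n3, by simpa using h1.n4,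
      by simpa using h1.n16, h1.r7, h1.r11⟩, h2⟩
  · rintro l s hl ⟨h1, -, h3, h4⟩ h5 - -
    rw [runs_seq]
    refine Runs.mono (runs_cov hO hn h1.n2 h1.n4 h1.n16 h1.r11 h5 (by decide)) ?_
    rintro s' t ⟨ht, hc⟩ hF
    have hE := h1.frame hF (by decide) (by decide)
    have e2 : s'.narr 2 = s.narr 2 := hF.narr 2 (by decide)
    have e5 : s'.nvar 5 = l := (hF.nvar 5 (by decide)).trans h5
    rw [runs_instr]
    have hct : t ≤ covTime n w m := ht.trans (covTime_mono hl.le)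
    refine ⟨by simp only [Instr.cost]; omega, ⟨hE.n2, hE.n3, hE.n4, hE.n16, hE.r7, hE.r11⟩,
      hl, ?_, ?_⟩
    · intro i hi
      simp only [Instr.apply, Function.update_self, e5, e2]
      rcases Nat.lt_succ_iff_lt_or_eq.1 hi with h | rfl
      · rw [Function.update_of_ne h.ne]; exact h3 i h
      · rw [Function.update_self]; exact hc.lt
    · simp only [Instr.apply, Function.update_self, e5, e2]
      intro q v hc'
      exact (h4 _ _ hc).step hc hc'
  · exact ⟨hs, by omega, by simp, fun q v _ b hb => by omega⟩
  · rintro s' t ⟨ht, h5, -, -, h⟩ -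
    exact ⟨ht, h5, h⟩

theorem runs_measure {O : Oracle} (hO : O.Bounded) {w n m L j : ℕ} {thr : ℝ} {s : State}
    (hn : 0 < n) (hs : Env n m thr s) (h5 : s.nvar 5 = L) (hj : thr ≤ 2 ^ j)
    (hj' : ∀ i < j, (2 : ℝ) ^ i < thr) :
    Runs O w measure s fun s' t => t ≤ covTime n w L + 3 * j + 4 ∧
      IsCoverage O.prox n (s.narr 2) L (s'.rvar 2) (s'.nvar 9) ∧ s'.rvar 8 = s'.rvar 2 ∧
      s'.rvar 5 = s'.rvar 2 ^ 2 ^ j := by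
  unfold measure
  simp only [runs_seq, runs_instr]
  refine Runs.mono (runs_cov hO hn hs.n2 hs.n4 hs.n16 hs.r11 h5 (by decide)) ?_
  rintro s' t ⟨ht, hc⟩ hF
  have hE := hs.frame hF (by decide) (by decide)
  refine Runs.mono (runs_pow (q := s'.rvar 2) (thr := thr) ?_ ?_ ?_ hj hj') ?_
  · simp [Instr.apply, hE.r11]
  · simp [Instr.apply]
  · simp [Instr.apply, hE.r7]
  · rintro s'' t' ⟨ht', h⟩ hF'
    have e2 : s''.rvar 2 = s'.rvar 2 := (hF'.rvar 2 (by decide)).trans (by simp [Instr.apply])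
    have e8 : s''.rvar 8 = s'.rvar 2 :=
      (hF'.rvar 8 (by decide)).trans (by simp [Instr.apply, hE.r11])
    have e9 : s''.nvar 9 = s'.nvar 9 := (hF'.nvar 9 (by decide)).trans (by simp [Instr.apply])
    rw [e2, e8, e9]
    refine ⟨?_, hc, rfl, h⟩
    have : t ≤ covTime n w L := ht
    simp only [Instr.cost]
    omega

theorem runs_extend {O : Oracle} (hO : O.Bounded) {w n m L j : ℕ} {thr : ℝ} {s : State}
    (hn : 0 < n) (hs : Env n m thr s) (h5 : s.nvar 5 = L) (hj : thr ≤ 2 ^ j)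
    (hj' : ∀ i < j, (2 : ℝ) ^ i < thr) :
    Runs O w extend s fun s' t => t ≤ covTime n w (L + 1) + 3 * j + 5 ∧ Env n m thr s' ∧
      s'.nvar 5 = L + 1 ∧ s'.rvar 8 = s.rvar 8 ∧
      s'.narr 2 = Function.update (s.narr 2) L (s.nvar 9) ∧
      IsCoverage O.prox n (s'.narr 2) (L + 1) (s'.rvar 2) (s'.nvar 9) ∧
      s'.rvar 5 = s'.rvar 2 ^ 2 ^ j := by
  unfold extend
  simp only [runs_seq, runs_instr]
  refine Runs.mono (runs_cov (n := n) (L := L + 1) hO hn ?_ ?_ ?_ ?_ ?_ (by decide)) ?_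
  · simp [Instr.apply, hs.n2]
  · simp [Instr.apply, hs.n4]
  · simp [Instr.apply, hs.n16]
  · simp [Instr.apply, hs.r11]
  · simp [Instr.apply, h5, hs.n4]
  rintro s' t ⟨ht, hc⟩ hF
  have hE : Env n m thr s' := by
    refine Env.frame ?_ hF (by decide) (by decide)
    constructor
    · simp [Instr.apply, hs.n2]
    · simp [Instr.apply, hs.n3]
    · simp [Instr.apply, hs.n4]
    · simp [Instr.apply, hs.n16]
    · simp [Instr.apply, hs.r7]
    · simp [Instr.apply, hs.r11]
  have e2 : s'.narr 2 = Function.update (s.narr 2) L (s.nvar 9) :=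
    (hF.narr 2 (by decide)).trans (by simp [Instr.apply, h5])
  have e5 : s'.nvar 5 = L + 1 := (hF.nvar 5 (by decide)).trans (by simp [Instr.apply, h5, hs.n4])
  have e8 : s'.rvar 8 = s.rvar 8 := (hF.rvar 8 (by decide)).trans (by simp [Instr.apply])
  refine Runs.mono (runs_pow (q := s'.rvar 2) hE.r11 rfl hE.r7 hj hj') ?_
  rintro s'' t' ⟨ht', h⟩ hF'
  refine ⟨?_, hE.frame hF' (by decide) (by decide), ?_, ?_, ?_, ?_, ?_⟩
  · have : t ≤ covTime n w (L + 1) := ht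
    simp only [Instr.cost]
    omega
  · rw [hF'.nvar 5 (by decide), e5]
  · rw [hF'.rvar 8 (by decide), e8]
  · rw [hF'.narr 2 (by decide), e2]
  · rw [hF'.narr 2 (by decide), hF'.nvar 9 (by decide), hF'.rvar 2 (by decide), e2]
    simpa [Instr.apply, h5] using hc
  · rw [hF'.rvar 2 (by decide), h]

/-- The loop that extends the traversal. -/
theorem runs_loop_extend {O : Oracle} (hO : O.Bounded) {w n m j NB : ℕ} {thr qm : ℝ} {s : State}
    (hn : 0 < n) (hj : thr ≤ 2 ^ j) (hj' : ∀ i < j, (2 : ℝ) ^ i < thr)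
    (hNB : ∀ A N qm, IsNet O.prox n m (2 ^ j) A N qm → N ≤ NB)
    (hs : Env n m thr s) (h5 : s.nvar 5 = m) (h8 : s.rvar 8 = qm)
    (hnet : IsNet O.prox n m (2 ^ j) (s.narr 2) m qm)
    (hc : IsCoverage O.prox n (s.narr 2) m (s.rvar 2) (s.nvar 9))
    (hsp : Spread O.prox (s.narr 2) m (s.rvar 2)) (hr5 : s.rvar 5 = s.rvar 2 ^ 2 ^ j) :
    Runs O w (.loop (.rlt 5 8) extend) s fun s' t =>
      t ≤ NB * (covTime n w NB + 3 * j + 6) + 1 ∧ Env n m thr s' ∧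
      IsNet O.prox n m (2 ^ j) (s'.narr 2) (s'.nvar 5) qm ∧
      ∃ q v, IsCoverage O.prox n (s'.narr 2) (s'.nvar 5) q v ∧ qm ≤ q ^ 2 ^ j := by
  refine Runs.mono (runs_loop (fun l s' => Env n m thr s' ∧ s'.nvar 5 = m + l ∧ s'.rvar 8 = qm ∧
    IsNet O.prox n m (2 ^ j) (s'.narr 2) (m + l) qm ∧
    IsCoverage O.prox n (s'.narr 2) (m + l) (s'.rvar 2) (s'.nvar 9) ∧
    Spread O.prox (s'.narr 2) (m + l) (s'.rvar 2) ∧ s'.rvar 5 = s'.rvar 2 ^ 2 ^ j) NB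
    (covTime n w NB + 3 * j + 5) ?_ ?_ ⟨hs, h5, h8, hnet, hc, hsp, hr5⟩) ?_
  -- Termination rests solely on the a priori bound `hNB` on the size of a net.
  · rintro l s ⟨-, -, -, h, -⟩
    exact le_of_add_le_right (hNB _ _ _ h)
  · rintro l s ⟨h1, h2, h3, h4, h5, h6, h7⟩ hlt
    simp only [Test.holds, h3, h7] at hlt
    refine Runs.mono (runs_extend hO hn h1 h2 hj hj') ?_
    rintro s' t ⟨ht, g1, g2, g3, g4, g5, g6⟩ -
    have hold : ∀ i < m, s'.narr 2 i = s.narr 2 i := fun i hi => by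
      rw [g4, Function.update_of_ne (by omega)]
    -- The separation is witnessed by the coverage before the new point was added, which passed the
    -- loop test.
    have hnet' : IsNet O.prox n m (2 ^ j) (s'.narr 2) (m + l + 1) qm := by
      refine ⟨by omega, ?_, ?_, h4.spread.congr hold, Or.inr ⟨_, hlt, g4 ▸ h6.snoc h5⟩⟩
      · intro i hi
        rw [g4]
        rcases Nat.lt_succ_iff_lt_or_eq.1 hi with h | rfl
        · rw [Function.update_of_ne h.ne]; exact h4.lt i h
        · rw [Function.update_self]; exact h5.lt
      · obtain ⟨v, hv⟩ := h4.coverage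
        exact ⟨v, hv.congr hold⟩
    have hle := covTime_mono (n := n) (w := w) (hNB _ _ _ hnet')
    refine ⟨by omega, g1, g2, g3.trans h3, hnet', g5, ?_, g6⟩
    rw [g4] at g5 ⊢
    exact h6.step h5 g5
  · rintro s' t ⟨ht, ⟨l, h1, h2, h3, h4, h5, h6, h7⟩, hnot⟩ -
    rw [h2]
    refine ⟨ht, h1, h4, _, _, h5, ?_⟩
    simp only [Test.holds, h3, h7, not_lt] at hnot
    exact hnot

/-- The output is empty, or the star on a tuple of coverage at least `q`. -/
def Best (O : Oracle) (n m : ℕ) (q : ℝ) (s : State) : Prop :=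
  q = 0 ∧ s.nvar 0 = 0 ∨ ∃ B : ℕ → ℕ, (∀ i < m, B i < n) ∧ (∀ u < n, ∃ i < m, q ≤ O.prox u (B i)) ∧
    IsStar O.adj B m (s.nvar 0) (s.narr 0) (s.narr 1)

theorem Best.congr {O : Oracle} {n m : ℕ} {q : ℝ} {s s' : State} (h : Best O n m q s)
    (h0 : s'.nvar 0 = s.nvar 0) (h1 : s'.narr 0 = s.narr 0) (h2 : s'.narr 1 = s.narr 1) :
    Best O n m q s' := by
  unfold Best
  rwa [h0, h1, h2]

/-- The base `N` digits of `c` index the net points of the current tuple. That the record `rvar 9`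
is at least the coverage of this tuple is expressed by one badly covered vertex `v`. -/
theorem runs_tryTuple {O : Oracle} (hO : O.Bounded) {w n m N c : ℕ} {thr : ℝ} {s : State}
    (hn : 0 < n) (hm : 0 < m) (hN : 0 < N) (hs : Env n m thr s) (h5 : s.nvar 5 = N)
    (hA : ∀ i < N, s.narr 2 i < n) (hD : ∀ i < m, s.narr 4 i = c / N ^ i % N)
    (hb : Best O n m (s.rvar 9) s) :
    Runs O w tryTuple s fun s' t => t ≤ covTime n w m + 25 * m + 13 ∧ Env n m thr s' ∧
      s'.nvar 5 = N ∧ s'.narr 2 = s.narr 2 ∧ (∀ i < m, s'.narr 4 i = (c + 1) / N ^ i % N) ∧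
      s'.nvar 10 = (if N ^ m ∣ c + 1 then 1 else 0) ∧ s.rvar 9 ≤ s'.rvar 9 ∧
      (∃ v < n, ∀ i < m, O.prox v (s.narr 2 (c / N ^ i % N)) ≤ s'.rvar 9) ∧
      Best O n m (s'.rvar 9) s' := by
  unfold tryTuple
  rw [runs_seq]
  refine Runs.mono (runs_fill hs.n3 hs.n4) ?_
  rintro s₁ t₁ ⟨ht₁, hB⟩ hF₁
  have hE₁ := hs.frame hF₁ (by decide) (by decide)
  rw [runs_seq]
  refine Runs.mono (runs_cov hO hn hE₁.n2 hE₁.n4 hE₁.n16 hE₁.r11 hE₁.n3 (by decide)) ?_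
  rintro s₂ t₂ ⟨ht₂, hc⟩ hF₂
  have hE₂ := hE₁.frame hF₂ (by decide) (by decide)
  rw [runs_seq]
  have hB' : ∀ i < m, s₁.narr 3 i = s.narr 2 (c / N ^ i % N) := fun i hi => by rw [hB i hi, hD i hi]
  have e9 : s₂.rvar 9 = s.rvar 9 := by rw [hF₂.rvar 9 (by decide), hF₁.rvar 9 (by decide)]
  have hcovt : t₂ ≤ covTime n w m := ht₂
  have mid : Runs O w (.branch (.rlt 9 2) (.instr (.radd 9 2 11) ;; emit) .skip) s₂ fun s₃ t₃ =>
      t₃ ≤ 10 * m + 6 ∧ s.rvar 9 ≤ s₃.rvar 9 ∧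
      (∃ v < n, ∀ i < m, O.prox v (s.narr 2 (c / N ^ i % N)) ≤ s₃.rvar 9) ∧
      Best O n m (s₃.rvar 9) s₃ := by
    simp only [runs_branch, runs_seq, runs_instr, runs_skip, Test.holds, e9]
    constructor
    · intro hlt
      refine Runs.mono (runs_emit (m := m) ?_ ?_ ?_) ?_
      · simp [Instr.apply, hE₂.n3]
      · simp [Instr.apply, hE₂.n4]
      · simp [Instr.apply, hE₂.n16]
      · rintro s₃ t₃ ⟨ht₃, hstar⟩ hF₃
        have e9' : s₃.rvar 9 = s₂.rvar 2 := by
          rw [hF₃.rvar 9 (by decide)]; simp [Instr.apply, hE₂.r11]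
        have e3 : s₂.narr 3 = s₁.narr 3 := hF₂.narr 3 (by decide)
        rw [e9']
        refine ⟨by simp only [Instr.cost]; omega, hlt.le,
          ⟨_, hc.lt, fun i hi => by rw [← hB' i hi]; exact hc.le i hi⟩,
          Or.inr ⟨s₁.narr 3, ?_, hc.cover hm, ?_⟩⟩
        · intro i hi
          rw [hB' i hi]
          exact hA _ (Nat.mod_lt _ hN)
        · simpa [Instr.apply, e3] using hstar
    · intro hle
      refine ⟨by omega, le_rfl, ⟨_, hc.lt, fun i hi => ?_⟩, hb.congr ?_ ?_ ?_⟩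
      · rw [← hB' i hi]
        exact (hc.le i hi).trans (not_lt.1 hle)
      · rw [hF₂.nvar 0 (by decide), hF₁.nvar 0 (by decide)]
      · rw [hF₂.narr 0 (by decide), hF₁.narr 0 (by decide)]
      · rw [hF₂.narr 1 (by decide), hF₁.narr 1 (by decide)]
  refine Runs.mono mid ?_
  rintro s₃ t₃ ⟨ht₃, h1, h2, h3⟩ hF₃
  have hE₃ := hE₂.frame hF₃ (by decide) (by decide)
  refine Runs.mono (runs_odometer (c := c) hN hE₃.n3 hE₃.n4 (N := N) ?_ hE₃.n16 ?_) ?_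
  · rw [hF₃.nvar 5 (by decide), hF₂.nvar 5 (by decide), hF₁.nvar 5 (by decide), h5]
  · rw [hF₃.narr 4 (by decide), hF₂.narr 4 (by decide), hF₁.narr 4 (by decide)]
    exact hD
  · rintro s₄ t₄ ⟨ht₄, g1, g2⟩ hF₄
    have e9' : s₄.rvar 9 = s₃.rvar 9 := hF₄.rvar 9 (by decide)
    rw [e9']
    refine ⟨by omega, hE₃.frame hF₄ (by decide) (by decide), ?_, ?_, g1, g2, h1, h2,
      h3.congr ?_ ?_ ?_⟩
    · rw [hF₄.nvar 5 (by decide), hF₃.nvar 5 (by decide), hF₂.nvar 5 (by decide),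
        hF₁.nvar 5 (by decide), h5]
    · rw [hF₄.narr 2 (by decide), hF₃.narr 2 (by decide), hF₂.narr 2 (by decide),
        hF₁.narr 2 (by decide)]
    · exact hF₄.nvar 0 (by decide)
    · exact hF₄.narr 0 (by decide)
    · exact hF₄.narr 1 (by decide)

theorem runs_loop_tryTuple {O : Oracle} (hO : O.Bounded) {w n m N : ℕ} {thr : ℝ} {s : State}
    (hn : 0 < n) (hm : 0 < m) (hN : 0 < N) (hs : Env n m thr s) (h5 : s.nvar 5 = N)
    (hA : ∀ i < N, s.narr 2 i < n) (hD : ∀ i, s.narr 4 i = 0) (h10 : s.nvar 10 = 0)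
    (h9 : s.rvar 9 = 0) (h0 : s.nvar 0 = 0) :
    Runs O w (.loop (.nlt 10 4) tryTuple) s fun s' t =>
      t ≤ N ^ m * (covTime n w m + 25 * m + 14) + 1 ∧
      (∀ c < N ^ m, ∃ v < n, ∀ i < m, O.prox v (s.narr 2 (c / N ^ i % N)) ≤ s'.rvar 9) ∧
      Best O n m (s'.rvar 9) s' := by
  refine Runs.mono (runs_loop (fun c s' => Env n m thr s' ∧ c ≤ N ^ m ∧ s'.nvar 5 = N ∧
    s'.narr 2 = s.narr 2 ∧ (∀ i < m, s'.narr 4 i = c / N ^ i % N) ∧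
    s'.nvar 10 = (if c = N ^ m then 1 else 0) ∧
    (∀ c' < c, ∃ v < n, ∀ i < m, O.prox v (s.narr 2 (c' / N ^ i % N)) ≤ s'.rvar 9) ∧
    Best O n m (s'.rvar 9) s') (N ^ m) (covTime n w m + 25 * m + 13) (fun l s h => h.2.1) ?_ ?_) ?_
  · rintro c s' ⟨h1, h2, h3, h4, h5, h6, h7, h8⟩ hlt
    simp only [Test.holds, h6, h1.n4] at hlt
    have hc : c < N ^ m := by
      refine lt_of_le_of_ne h2 fun h => ?_
      rw [if_pos h] at hlt
      omega
    refine Runs.mono (runs_tryTuple hO hn hm hN h1 h3 (by rwa [h4]) h5 h8) ?_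
    rintro s'' t ⟨ht, g1, g2, g3, g4, g5, g6, g7, g8⟩ -
    refine ⟨ht, g1, hc, g2, g3.trans h4, g4, ?_, ?_, g8⟩
    · rw [g5]
      -- As `c + 1 ≤ N ^ m`, the carry out of the last digit occurs only at the very end.
      have : N ^ m ∣ c + 1 ↔ c + 1 = N ^ m :=
        ⟨fun h => le_antisymm hc (Nat.le_of_dvd (by omega) h), fun h => h ▸ dvd_rfl⟩
      simp only [this]
    · intro c' hc'
      rcases Nat.lt_succ_iff_lt_or_eq.1 hc' with h | rfl
      · obtain ⟨v, hv, h'⟩ := h7 c' h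
        exact ⟨v, hv, fun i hi => (h' i hi).trans g6⟩
      · rw [← h4]
        exact g7
  · refine ⟨hs, Nat.zero_le _, h5, rfl, fun i _ => by simp [hD], ?_, by simp, Or.inl ⟨h9, h0⟩⟩
    rw [h10, if_neg]
    positivity
  · rintro s' t ⟨ht, ⟨c, h1, h2, h3, h4, h5, h6, h7, h8⟩, hnot⟩ -
    simp only [Test.holds, h6, h1.n4] at hnot
    have : c = N ^ m := by
      by_contra h
      simp [h] at hnot
    subst this
    exact ⟨ht, h7, h8⟩

/-- A bound on the number of steps of `core`. -/
def coreTime (n w m j N : ℕ) : ℕ :=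
  m * (covTime n w m + 3) + 2 + (covTime n w m + 3 * j + 4) +
    (N * (covTime n w N + 3 * j + 6) + 1) + (N ^ m * (covTime n w m + 25 * m + 14) + 1)

theorem runs_core {O : Oracle} (hO : O.Bounded) {w n m j NB : ℕ} {thr : ℝ} {s : State}
    (hn : 0 < n) (hm : 0 < m) (hj : thr ≤ 2 ^ j) (hj' : ∀ i < j, (2 : ℝ) ^ i < thr)
    (hNB : ∀ A N qm, IsNet O.prox n m (2 ^ j) A N qm → N ≤ NB)
    (hs : Env n m thr s) (hD : ∀ i, s.narr 4 i = 0) (h10 : s.nvar 10 = 0)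
    (h9 : s.rvar 9 = 0) (h0 : s.nvar 0 = 0) :
    Runs O w core s fun s' t => t ≤ coreTime n w m j NB ∧ ∃ A N qm bq,
      IsNet O.prox n m (2 ^ j) A N qm ∧
      (∃ q v, IsCoverage O.prox n A N q v ∧ qm ≤ q ^ 2 ^ j) ∧
      (∀ c < N ^ m, ∃ v < n, ∀ i < m, O.prox v (A (c / N ^ i % N)) ≤ bq) ∧
      Best O n m bq s' := by
  unfold core
  rw [runs_seq]
  refine Runs.mono (runs_traverse hO hn hs) ?_
  rintro s₁ t₁ ⟨ht₁, h5, hA, hsp⟩ hF₁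
  have hE₁ := hs.frame hF₁ (by decide) (by decide)
  rw [runs_seq]
  refine Runs.mono (runs_measure hO hn hE₁ h5 hj hj') ?_
  rintro s₂ t₂ ⟨ht₂, hc, e8, e5⟩ hF₂
  have hE₂ := hE₁.frame hF₂ (by decide) (by decide)
  have e2 : s₂.narr 2 = s₁.narr 2 := hF₂.narr 2 (by decide)
  rw [← e2] at hc hA hsp
  rw [runs_seq]
  have hnet : IsNet O.prox n m (2 ^ j) (s₂.narr 2) m (s₂.rvar 2) :=
    ⟨le_rfl, hA, ⟨_, hc⟩, hsp _ _ hc, Or.inl rfl⟩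
  refine Runs.mono (runs_loop_extend hO hn hj hj' hNB hE₂
    ((hF₂.nvar 5 (by decide)).trans h5) e8 hnet hc (hsp _ _ hc) e5) ?_
  rintro s₃ t₃ ⟨ht₃, hE₃, hnet₃, hcov⟩ hF₃
  refine Runs.mono (runs_loop_tryTuple hO hn hm (hm.trans_le hnet₃.le) hE₃ rfl hnet₃.lt ?_ ?_ ?_ ?_)
    ?_
  · rw [hF₃.narr 4 (by decide), hF₂.narr 4 (by decide), hF₁.narr 4 (by decide)]
    exact hD
  · rw [hF₃.nvar 10 (by decide), hF₂.nvar 10 (by decide), hF₁.nvar 10 (by decide), h10]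
  · rw [hF₃.rvar 9 (by decide), hF₂.rvar 9 (by decide), hF₁.rvar 9 (by decide), h9]
  · rw [hF₃.nvar 0 (by decide), hF₂.nvar 0 (by decide), hF₁.nvar 0 (by decide), h0]
  · rintro s₄ t₄ ⟨ht₄, h1, h2⟩ -
    refine ⟨?_, _, _, _, _, hnet₃, hcov, h1, h2⟩
    have hle := Nat.mul_le_mul_right (covTime n w m + 25 * m + 14)
      (Nat.pow_le_pow_left (hNB _ _ _ hnet₃) m)
    unfold coreTime
    omega

/-- The whole program; `i` stores the number of centres in `nvar 3`. -/
def main (i : Instr) : Prog :=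
  .instr (.nconst 4 1) ;; .instr (.nadd 2 0 16) ;; .instr (.nconst 0 0) ;; .instr (.rconst 10 1) ;;
  .branch (.nlt 16 1) (.branch (.nlt 4 2) (.branch (.rlt 0 10)
    (.instr i ;; .instr (.rconst 5 4) ;; .instr (.rdiv 7 5 1) ;; .instr (.rconst 5 32) ;;
      .instr (.radd 7 7 5) ;; core) .skip) .skip) .skip

theorem runs_main_trivial {O : Oracle} {w n k : ℕ} {α ε : ℝ} (i : Instr)
    (h : k = 0 ∨ n < 2 ∨ ¬ α < 1) :
    Runs O w (main i) (initState n k α ε) fun s' t => t ≤ 10 ∧ s'.nvar 0 = 0 := by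
  unfold main
  simp only [runs_seq, runs_instr, runs_branch, runs_skip, Test.holds]
  refine ⟨fun h₁ => ⟨fun h₂ => ⟨fun h₃ => ?_, fun _ => ?_⟩, fun _ => ?_⟩, fun _ => ?_⟩
  · have h₁ : 0 < k := by simpa [Instr.apply, initState] using h₁
    have h₂ : 1 < n := by simpa [Instr.apply, initState] using h₂
    have h₃ : α < 1 := by simpa [Instr.apply, initState] using h₃
    rcases h with h | h | h
    · omega
    · omega
    · exact absurd h₃ h
  all_goals simp [Instr.apply, Instr.cost]

/-- Variables `1` and `4` hold `k` and `1`, so the choice of `z` makes the number of centres `k + k`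
or `k + 1`; the two algorithms differ in nothing else. -/
theorem runs_main {O : Oracle} (hO : O.Bounded) {w n k m j NB : ℕ} {α ε : ℝ} (z : ℕ)
    (hz : z = 1 ∧ m = k + k ∨ z = 4 ∧ m = k + 1)
    (hn : 2 ≤ n) (hk : 0 < k) (hα : α < 1)
    (hj : 4 / ε + 32 ≤ 2 ^ j) (hj' : ∀ i < j, (2 : ℝ) ^ i < 4 / ε + 32)
    (hNB : ∀ A N qm, IsNet O.prox n m (2 ^ j) A N qm → N ≤ NB) :
    Runs O w (main (.nadd 3 1 z)) (initState n k α ε) fun s' t => t ≤ coreTime n w m j NB + 12 ∧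
      ∃ A N qm bq, IsNet O.prox n m (2 ^ j) A N qm ∧
      (∃ q v, IsCoverage O.prox n A N q v ∧ qm ≤ q ^ 2 ^ j) ∧
      (∀ c < N ^ m, ∃ v < n, ∀ i < m, O.prox v (A (c / N ^ i % N)) ≤ bq) ∧
      Best O n m bq s' := by
  have hm : 0 < m := by omega
  unfold main
  simp only [runs_seq, runs_instr, runs_branch, runs_skip, Test.holds]
  refine ⟨fun _ => ⟨fun _ => ⟨fun _ => ?_, fun h => ?_⟩, fun h => ?_⟩, fun h => ?_⟩
  · refine Runs.mono (runs_core (n := n) hO (by omega) hm hj hj' hNB ?_ ?_ ?_ ?_ ?_) ?_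
    · constructor
      · simp [Instr.apply, initState]
      · rcases hz with ⟨rfl, rfl⟩ | ⟨rfl, rfl⟩ <;> simp [Instr.apply, initState]
      · simp [Instr.apply, initState]
      · simp [Instr.apply, initState]
      · simp [Instr.apply, initState]
      · simp [Instr.apply, initState]
    · simp [Instr.apply, initState]
    · simp [Instr.apply, initState]
    · simp [Instr.apply, initState]
    · simp [Instr.apply, initState]
    · rintro s' t ⟨ht, h⟩ -
      refine ⟨?_, h⟩
      simp only [Instr.cost]
      omega
  · exact absurd (by simpa [Instr.apply, initState] using hα) h
  · exact absurd (by simp [Instr.apply, initState]; omega) h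
  · exact absurd (by simpa [Instr.apply, initState] using hk) h

end RealRAM
-- Product measure on subsets: the Harris and van den Berg–Kesten inequalities.
namespace InfoGraph

section Percolation
open scoped Classical

variable {ι : Type*} {α : ℝ} {E F : Finset ι} {e : ι} {f g : Finset ι → ℝ}

/-- The expectation of `f` at the random subset of `E` that contains every element independently
with probability `α`. -/
noncomputable def expect (α : ℝ) (E : Finset ι) (f : Finset ι → ℝ) : ℝ :=
  ∑ A ∈ E.powerset, α ^ A.card * (1 - α) ^ (E.card - A.card) * f A

/-- The indicator of a proposition. -/
noncomputable def ind (p : Prop) : ℝ := if p then 1 else 0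

theorem ind_nonneg (p : Prop) : 0 ≤ ind p := by unfold ind; split_ifs <;> norm_num

theorem ind_le_one (p : Prop) : ind p ≤ 1 := by unfold ind; split_ifs <;> norm_num

theorem ind_mono {p q : Prop} (h : p → q) : ind p ≤ ind q := by
  by_cases hp : p <;> by_cases hq : q <;> simp_all [ind]

theorem ind_and (p q : Prop) : ind (p ∧ q) = ind p * ind q := by
  by_cases hp : p <;> by_cases hq : q <;> simp_all [ind]

theorem ind_or_le (p q : Prop) : ind (p ∨ q) ≤ ind p + ind q := by
  by_cases hp : p <;> by_cases hq : q <;> simp_all [ind]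

theorem ind_of {p : Prop} (h : p) : ind p = 1 := if_pos h

theorem ind_of_not {p : Prop} (h : ¬ p) : ind p = 0 := if_neg h

theorem expect_empty : expect α ∅ f = f ∅ := by simp [expect]

theorem expect_add : expect α E (fun A => f A + g A) = expect α E f + expect α E g := by
  simp [expect, mul_add, Finset.sum_add_distrib]

theorem expect_const_mul (c : ℝ) : expect α E (fun A => c * f A) = c * expect α E f := by
  simp only [expect, Finset.mul_sum]
  exact Finset.sum_congr rfl fun A _ => by ring

theorem expect_mul_const (c : ℝ) : expect α E (fun A => f A * c) = expect α E f * c := by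
  simp only [expect, Finset.sum_mul]
  exact Finset.sum_congr rfl fun A _ => by ring

theorem expect_sum {κ : Type*} (S : Finset κ) (f : κ → Finset ι → ℝ) :
    expect α E (fun A => ∑ i ∈ S, f i A) = ∑ i ∈ S, expect α E (f i) := by
  simp only [expect, Finset.mul_sum]
  exact Finset.sum_comm

theorem expect_mono (h0 : 0 ≤ α) (h1 : α ≤ 1) (h : ∀ A ⊆ E, f A ≤ g A) :
    expect α E f ≤ expect α E g := by
  refine Finset.sum_le_sum fun A hA => mul_le_mul_of_nonneg_left (h A (Finset.mem_powerset.1 hA)) ?_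
  have : 0 ≤ 1 - α := by linarith
  positivity

theorem expect_pos (h0 : 0 < α) (h1 : α ≤ 1) (hf : ∀ A, 0 ≤ f A) (hE : 0 < f E) :
    0 < expect α E f := by
  have h1' : 0 ≤ 1 - α := by linarith
  refine lt_of_lt_of_le ?_ (Finset.single_le_sum (fun A _ => ?_) (Finset.mem_powerset_self E))
  · simp only [Nat.sub_self, pow_zero, mul_one]
    positivity
  · have := hf A
    positivity

/-- `Z` occurs for two disjoint subsets of `A`. -/
def Disjointly (Z : Finset ι → Finset ι → Prop) (A : Finset ι) : Prop :=
  ∃ A₁ ⊆ A, ∃ A₂ ⊆ A, Disjoint A₁ A₂ ∧ Z A₁ A₂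

theorem Disjointly.imp {Z Z' : Finset ι → Finset ι → Prop} {A : Finset ι}
    (hZ : ∀ A B, Z A B → Z' A B) (h : Disjointly Z A) : Disjointly Z' A := by
  obtain ⟨A₁, h₁, A₂, h₂, hd, h⟩ := h
  exact ⟨A₁, h₁, A₂, h₂, hd, hZ _ _ h⟩

variable [DecidableEq ι]

/-- Conditioning on a single element; the inductions on `E` below all rest on this recursion. -/
theorem expect_insert (he : e ∉ E) : expect α (insert e E) f =
    α * expect α E (fun A => f (insert e A)) + (1 - α) * expect α E f := by
  unfold expect
  rw [Finset.sum_powerset_insert he, Finset.mul_sum, Finset.mul_sum, add_comm]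
  congr 1 <;> refine Finset.sum_congr rfl fun A hA => ?_
  · have hA' := Finset.mem_powerset.1 hA
    have h1 : e ∉ A := fun h => he (hA' h)
    rw [Finset.card_insert_of_notMem h1, Finset.card_insert_of_notMem he, Nat.add_sub_add_right]
    ring
  · have hA' := Finset.card_le_card (Finset.mem_powerset.1 hA)
    rw [Finset.card_insert_of_notMem he, Nat.succ_sub hA', pow_succ]
    ring

theorem expect_const (c : ℝ) : expect α E (fun _ => c) = c := by
  induction E using Finset.induction_on with
  | empty => exact expect_empty
  | insert e E he ih => rw [expect_insert he, ih]; ring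

theorem expect_nonneg (h0 : 0 ≤ α) (h1 : α ≤ 1) (h : ∀ A, 0 ≤ f A) : 0 ≤ expect α E f := by
  have := expect_mono (E := E) (f := fun _ => 0) (g := f) h0 h1 fun A _ => h A
  rwa [expect_const] at this

/-- **Harris' inequality**. -/
theorem expect_mul_expect_le (h0 : 0 ≤ α) (h1 : α ≤ 1) (hf : Monotone f) (hg : Monotone g) :
    expect α E f * expect α E g ≤ expect α E fun A => f A * g A := by
  induction E using Finset.induction_on generalizing f g with
  | empty => simp [expect_empty]
  | insert e E he ih =>
    rw [expect_insert he, expect_insert he, expect_insert he]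
    have hins : Monotone fun A : Finset ι => insert e A :=
      fun A B h => Finset.insert_subset_insert e h
    have i1 := ih (hf.comp hins) (hg.comp hins)
    have i0 := ih hf hg
    have f1 : expect α E f ≤ expect α E (f ∘ fun A => insert e A) :=
      expect_mono h0 h1 fun A _ => hf (Finset.subset_insert e A)
    have g1 : expect α E g ≤ expect α E (g ∘ fun A => insert e A) :=
      expect_mono h0 h1 fun A _ => hg (Finset.subset_insert e A)
    change (α * expect α E (f ∘ fun A => insert e A) + _) *
      (α * expect α E (g ∘ fun A => insert e A) + _) ≤
      α * (expect α E fun A => (f ∘ fun A => insert e A) A * (g ∘ fun A => insert e A) A) + _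
    have h1' : 0 ≤ 1 - α := by linarith
    -- The covariance contributed by `e`: both functions increase when `e` is added, and the product
    -- of the increments enters with weight `α * (1 - α)`.
    have k := mul_nonneg (mul_nonneg h0 h1') (mul_nonneg (sub_nonneg.2 f1) (sub_nonneg.2 g1))
    have k1 := mul_le_mul_of_nonneg_left i1 h0
    have k0 := mul_le_mul_of_nonneg_left i0 h1'
    nlinarith

/-- The element `e` can serve at most one of two disjoint witnesses. If it serves neither,
monotonicity of `Z` allows giving it to the second. -/
theorem Disjointly.of_insert {Z : Finset ι → Finset ι → Prop} {A : Finset ι}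
    (hZ : ∀ A A' B B', A ⊆ A' → B ⊆ B' → Z A B → Z A' B') (h : Disjointly Z (insert e A)) :
    Disjointly (fun A B => Z (insert e A) B) A ∨ Disjointly (fun A B => Z A (insert e B)) A := by
  obtain ⟨A₁, h₁, A₂, h₂, hd, h⟩ := h
  by_cases e₁ : e ∈ A₁
  · have e₂ : e ∉ A₂ := Finset.disjoint_left.1 hd e₁
    refine Or.inl ⟨A₁.erase e, Finset.subset_insert_iff.1 h₁, A₂,
      (Finset.subset_insert_iff_of_notMem e₂).1 h₂,
      hd.mono_left (Finset.erase_subset _ _), ?_⟩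
    simpa only [Finset.insert_erase e₁] using h
  · refine Or.inr ⟨A₁, (Finset.subset_insert_iff_of_notMem e₁).1 h₁, A₂.erase e,
      Finset.subset_insert_iff.1 h₂, hd.mono_right (Finset.erase_subset _ _),
      hZ _ _ _ _ subset_rfl ?_ h⟩
    intro x hx
    by_cases hxe : x = e <;> simp [hxe, hx]

/-- The **van den Berg–Kesten inequality**, for an increasing event of pairs of sets. -/
theorem expect_disjointly_le (h0 : 0 ≤ α) (h1 : α ≤ 1) (Z : Finset ι → Finset ι → Prop)
    (hZ : ∀ A A' B B', A ⊆ A' → B ⊆ B' → Z A B → Z A' B') :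
    expect α E (fun A => ind (Disjointly Z A)) ≤
      expect α E fun A => expect α E fun B => ind (Z A B) := by
  induction E using Finset.induction_on generalizing Z with
  | empty =>
    simp only [expect_empty]
    refine ind_mono ?_
    rintro ⟨A₁, h₁, A₂, h₂, -, h⟩
    rwa [Finset.subset_empty.1 h₁, Finset.subset_empty.1 h₂] at h
  | insert e E he ih =>
    have hi : ∀ {A A' : Finset ι}, A ⊆ A' → insert e A ⊆ insert e A' :=
      fun h => Finset.insert_subset_insert e h
    have i11 := ih (fun A B => Z (insert e A) (insert e B))
      fun A A' B B' hA hB => hZ _ _ _ _ (hi hA) (hi hB)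
    have i10 := ih (fun A B => Z (insert e A) B) fun A A' B B' hA hB => hZ _ _ _ _ (hi hA) hB
    have i01 := ih (fun A B => Z A (insert e B)) fun A A' B B' hA hB => hZ _ _ _ _ hA (hi hB)
    have i00 := ih Z hZ
    have h1' : 0 ≤ 1 - α := by linarith
    -- The element `e` is replaced by two independent copies, one for each argument of `Z`. It
    -- suffices to compare pointwise in `A`: with `e` present, one of the two mixed events must
    -- hold, and each mixed event implies the event with both copies; with `e` absent, all four
    -- events hold.
    have lhs : expect α (insert e E) (fun A => ind (Disjointly Z A)) ≤
        α ^ 2 * expect α E (fun A => ind (Disjointly (fun A B => Z (insert e A) (insert e B)) A)) +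
        α * (1 - α) * (expect α E (fun A => ind (Disjointly (fun A B => Z (insert e A) B) A)) +
          expect α E (fun A => ind (Disjointly (fun A B => Z A (insert e B)) A))) +
        (1 - α) ^ 2 * expect α E (fun A => ind (Disjointly Z A)) := by
      rw [expect_insert he]
      simp only [← expect_const_mul, ← expect_add]
      refine expect_mono h0 h1 fun A _ => ?_
      have a1 : Disjointly (fun A B => Z (insert e A) B) A →
          Disjointly (fun A B => Z (insert e A) (insert e B)) A :=
        Disjointly.imp fun A B => hZ _ _ _ _ subset_rfl (Finset.subset_insert e B)
      have a2 : Disjointly (fun A B => Z A (insert e B)) A →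
          Disjointly (fun A B => Z (insert e A) (insert e B)) A :=
        Disjointly.imp fun A B => hZ _ _ _ _ (Finset.subset_insert e A) subset_rfl
      have a3 : Disjointly Z A → Disjointly (fun A B => Z (insert e A) B) A :=
        Disjointly.imp fun A B => hZ _ _ _ _ (Finset.subset_insert e A) subset_rfl
      have a4 : Disjointly Z A → Disjointly (fun A B => Z A (insert e B)) A :=
        Disjointly.imp fun A B => hZ _ _ _ _ subset_rfl (Finset.subset_insert e B)
      have a5 : Disjointly Z (insert e A) → _ := Disjointly.of_insert hZ
      by_cases c1 : Disjointly (fun A B => Z (insert e A) B) A <;>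
      by_cases c2 : Disjointly (fun A B => Z A (insert e B)) A <;>
      by_cases c0 : Disjointly Z A
      · have := ind_le_one (Disjointly Z (insert e A))
        rw [ind_of c1, ind_of c2, ind_of c0, ind_of (a1 c1)]
        nlinarith
      · have := ind_le_one (Disjointly Z (insert e A))
        rw [ind_of c1, ind_of c2, ind_of_not c0, ind_of (a1 c1)]
        nlinarith
      · exact absurd (a4 c0) c2
      · have := ind_le_one (Disjointly Z (insert e A))
        rw [ind_of c1, ind_of_not c2, ind_of_not c0, ind_of (a1 c1)]
        nlinarith
      · exact absurd (a3 c0) c1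
      · have := ind_le_one (Disjointly Z (insert e A))
        rw [ind_of_not c1, ind_of c2, ind_of_not c0, ind_of (a2 c2)]
        nlinarith
      · exact absurd (a3 c0) c1
      · have := ind_nonneg (Disjointly (fun A B => Z (insert e A) (insert e B)) A)
        rw [ind_of_not c1, ind_of_not c2, ind_of_not c0,
          ind_of_not fun h => (a5 h).elim c1 c2]
        nlinarith [mul_nonneg (sq_nonneg α) this]
    refine lhs.trans ?_
    rw [expect_insert he]
    simp only [expect_insert he, expect_add, expect_const_mul]
    have k11 := mul_le_mul_of_nonneg_left i11 (sq_nonneg α)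
    have k10 := mul_le_mul_of_nonneg_left i10 (mul_nonneg h0 h1')
    have k01 := mul_le_mul_of_nonneg_left i01 (mul_nonneg h0 h1')
    have k00 := mul_le_mul_of_nonneg_left i00 (sq_nonneg (1 - α))
    linarith

theorem expect_le_of_subset (h0 : 0 ≤ α) (h1 : α ≤ 1) (hf : Monotone f) (h : E ⊆ F) :
    expect α E f ≤ expect α F f := by
  suffices H : ∀ D : Finset ι, Disjoint E D → expect α E f ≤ expect α (E ∪ D) f by
    have := H (F \ E) Finset.disjoint_sdiff
    rwa [Finset.union_sdiff_of_subset h] at this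
  intro D
  induction D using Finset.induction_on with
  | empty => simp
  | insert e D he ih =>
    intro hd
    rw [Finset.disjoint_insert_right] at hd
    refine (ih hd.2).trans ?_
    rw [Finset.union_insert, expect_insert (by simp [he, hd.1])]
    have : expect α (E ∪ D) f ≤ expect α (E ∪ D) fun A => f (insert e A) :=
      expect_mono h0 h1 fun A _ => hf (Finset.subset_insert e A)
    nlinarith

theorem expect_union (hd : Disjoint E F) :
    expect α (E ∪ F) (fun A => f (A ∩ E)) = expect α E f := by
  induction F using Finset.induction_on with
  | empty =>
    rw [Finset.union_empty]
    refine Finset.sum_congr rfl fun A hA => ?_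
    beta_reduce
    rw [Finset.inter_eq_left.2 (Finset.mem_powerset.1 hA)]
  | insert e D he ih =>
    rw [Finset.disjoint_insert_right] at hd
    rw [Finset.union_insert, expect_insert (by simp [he, hd.1])]
    simp only [Finset.insert_inter_of_notMem hd.1, ih hd.2]
    ring

/-- Independence of an edge outside `E` from what happens inside `E`. -/
theorem expect_union_mem (hd : Disjoint E F) (he : e ∈ F) :
    expect α (E ∪ F) (fun A => ind (e ∈ A) * f (A ∩ E)) = α * expect α E f := by
  have heE : e ∉ E := fun h => Finset.disjoint_left.1 hd h he
  have h1 : E ∪ F = insert e (E ∪ F.erase e) := by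
    rw [← Finset.union_insert, Finset.insert_erase he]
  have h2 : e ∉ E ∪ F.erase e := by simp [heE]
  have h3 : expect α (E ∪ F.erase e) (fun A => ind (e ∈ A) * f (A ∩ E)) =
      expect α (E ∪ F.erase e) fun _ => 0 := by
    refine Finset.sum_congr rfl fun A hA => ?_
    beta_reduce
    rw [ind_of_not fun h => h2 (Finset.mem_powerset.1 hA h), zero_mul]
  have h4 := expect_union (α := α) (f := f) (hd.mono_right (Finset.erase_subset e F))
  rw [h1, expect_insert h2, h3, expect_const]
  simp only [Finset.insert_inter_of_notMem heE, Finset.mem_insert_self, ind_of, one_mul, h4]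
  ring

theorem expect_lt_one (h0 : 0 ≤ α) (h1 : α < 1) (hf : ∀ A, f A ≤ 1) (hE : f ∅ = 0) :
    expect α E f < 1 := by
  have h1' : 0 < 1 - α := by linarith
  have e : expect α E (fun A => f A + (1 - f A)) = 1 := by simp [expect_const]
  rw [expect_add] at e
  have : 0 < expect α E fun A => 1 - f A := by
    refine lt_of_lt_of_le ?_ (Finset.single_le_sum (fun A _ => ?_) (Finset.empty_mem_powerset E))
    · simp only [Finset.card_empty, pow_zero, one_mul, hE, sub_zero, mul_one]
      positivity
    · have := sub_nonneg.2 (hf A)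
      positivity
  linarith

end Percolation

/-! ### Connection events, and the effect of extra edges on them. -/

section Connection
open scoped Classical

variable {V : Type*} {A B : Finset (Sym2 V)} {u v w a b : V} {S T : Finset V}

/-- The edges in `A` connect `u` and `v`. -/
def Linked (A : Finset (Sym2 V)) (u v : V) : Prop :=
  (SimpleGraph.fromEdgeSet (A : Set (Sym2 V))).Reachable u v

theorem Linked.refl (A : Finset (Sym2 V)) (u : V) : Linked A u u := SimpleGraph.Reachable.refl u

theorem Linked.symm (h : Linked A u v) : Linked A v u := SimpleGraph.Reachable.symm h

theorem Linked.trans (h : Linked A u v) (h' : Linked A v w) : Linked A u w :=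
  SimpleGraph.Reachable.trans h h'

theorem Linked.mono (h : Linked A u v) (hAB : A ⊆ B) : Linked B u v :=
  SimpleGraph.Reachable.mono (SimpleGraph.fromEdgeSet_mono (by exact_mod_cast hAB)) h

/-- The edges in `A` connect `v` to some vertex of `T`. -/
def LinkedTo (A : Finset (Sym2 V)) (T : Finset V) (v : V) : Prop := ∃ t ∈ T, Linked A t v

theorem LinkedTo.mono (h : LinkedTo A T v) (hAB : A ⊆ B) : LinkedTo B T v := by
  obtain ⟨t, ht, h⟩ := h
  exact ⟨t, ht, h.mono hAB⟩

theorem LinkedTo.trans (h : LinkedTo A T u) (h' : Linked A u v) : LinkedTo A T v := by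
  obtain ⟨t, ht, h⟩ := h
  exact ⟨t, ht, h.trans h'⟩

theorem monotone_linkedTo (T : Finset V) (v : V) :
    Monotone fun A : Finset (Sym2 V) => ind (LinkedTo A T v) :=
  fun _ _ h => ind_mono fun h' => h'.mono h

theorem monotone_linked (u v : V) : Monotone fun A : Finset (Sym2 V) => ind (Linked A u v) :=
  fun _ _ h => ind_mono fun h' => h'.mono h

variable [DecidableEq V]

theorem Linked.of_mem (h : s(u, v) ∈ A) : Linked A u v := by
  by_cases huv : u = v
  · exact huv ▸ Linked.refl A u
  · exact SimpleGraph.Adj.reachable (by simp [h, huv])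

theorem Linked.induction {P : V → Prop} (h0 : P u)
    (hstep : ∀ a b, Linked A u a → s(a, b) ∈ A → P a → P b) (h : Linked A u v) : P v := by
  have h' := (SimpleGraph.reachable_iff_reflTransGen u v).1 h
  clear h
  suffices Linked A u v ∧ P v from this.2
  induction h' with
  | refl => exact ⟨Linked.refl A u, h0⟩
  | @tail b c _ hbc ih =>
    have hmem : s(b, c) ∈ A := by simpa using ((SimpleGraph.fromEdgeSet_adj _).1 hbc).1
    exact ⟨ih.1.trans (.of_mem hmem), hstep _ _ ih.1 hmem ih.2⟩

/-- A connection need use the new edge at most once, in one of two directions. -/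
theorem Linked.of_insert (h : Linked (insert s(a, b) A) u v) :
    Linked A u v ∨ (Linked A u a ∧ Linked A b v) ∨ (Linked A u b ∧ Linked A a v) := by
  refine Linked.induction (P := fun v => Linked A u v ∨ (Linked A u a ∧ Linked A b v) ∨
    (Linked A u b ∧ Linked A a v)) (Or.inl (Linked.refl A u)) ?_ h
  rintro c d - hcd ih
  rcases Finset.mem_insert.1 hcd with he | hmem
  · rcases Sym2.eq_iff.1 he with ⟨rfl, rfl⟩ | ⟨rfl, rfl⟩
    · rcases ih with h | ⟨h, -⟩ | ⟨h, -⟩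
      · exact Or.inr (Or.inl ⟨h, Linked.refl A _⟩)
      · exact Or.inr (Or.inl ⟨h, Linked.refl A _⟩)
      · exact Or.inl h
    · rcases ih with h | ⟨h, -⟩ | ⟨h, -⟩
      · exact Or.inr (Or.inr ⟨h, Linked.refl A _⟩)
      · exact Or.inl h
      · exact Or.inr (Or.inr ⟨h, Linked.refl A _⟩)
  · have hl := Linked.of_mem hmem
    rcases ih with h | ⟨h, h'⟩ | ⟨h, h'⟩
    · exact Or.inl (h.trans hl)
    · exact Or.inr (Or.inl ⟨h, h'.trans hl⟩)
    · exact Or.inr (Or.inr ⟨h, h'.trans hl⟩)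

theorem Linked.restrict (h : Linked A u v) :
    Linked (A.filter fun e => ∃ x ∈ e, Linked A u x) u v := by
  refine Linked.induction (P := fun v => Linked (A.filter fun e => ∃ x ∈ e, Linked A u x) u v)
    (Linked.refl _ u) ?_ h
  intro a b ha hab ih
  exact ih.trans (.of_mem (Finset.mem_filter.2 ⟨hab, a, by simp, ha⟩))

/-- If `T` and `v` are not connected, the cluster of a suitable `t ∈ T` and that of `b` are
different components. The edges meeting each of them form disjoint witnesses. -/
theorem LinkedTo.disjointly (hn : ¬ LinkedTo A T v) (h : LinkedTo A T a) (h' : Linked A b v) :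
    Disjointly (fun A B => LinkedTo A T a ∧ Linked B b v) A := by
  obtain ⟨t, ht, h⟩ := h
  refine ⟨_, Finset.filter_subset _ _, _, Finset.filter_subset _ _, ?_,
    ⟨t, ht, h.restrict⟩, h'.restrict⟩
  rw [Finset.disjoint_left]
  intro e he he'
  obtain ⟨he, x, hx, htx⟩ := Finset.mem_filter.1 he
  obtain ⟨-, y, hy, hby⟩ := Finset.mem_filter.1 he'
  have hxy : Linked A x y := by
    by_cases hxy : x = y
    · exact hxy ▸ Linked.refl A x
    · rw [(Sym2.mem_and_mem_iff hxy).1 ⟨hx, hy⟩] at he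
      exact .of_mem he
  exact hn ⟨t, ht, (htx.trans hxy).trans (hby.symm.trans h')⟩

variable {α : ℝ} {E F : Finset (Sym2 V)}

/-- The probability that `v` is connected to `T`. -/
noncomputable def proxTo (α : ℝ) (E : Finset (Sym2 V)) (T : Finset V) (v : V) : ℝ :=
  expect α E fun A => ind (LinkedTo A T v)

/-- Write `p` for connection probabilities in `E`. If the new edge is essential, then `T`–`a` and
`b`–`v`, or `T`–`b` and `a`–`v`, occur disjointly, so by van den Berg–Kesten the gain is at most
`p(T,a) p(b,v) + p(T,b) p(a,v)`. The first product is at most `p(b,v)`; in the second, `p(T,b) ≤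
p(T,a)` and Harris give at most `p(T,v)`. Together with `p(T,v)` itself these are three terms, each
bounded by the connection probability to `insert b T`. -/
theorem proxTo_insert_le (h0 : 0 ≤ α) (h1 : α ≤ 1) (he : s(a, b) ∉ E)
    (hab : proxTo α E T b ≤ proxTo α E T a) (v : V) :
    proxTo α (insert s(a, b) E) T v ≤ 3 * proxTo α E (insert b T) v := by
  have bk : ∀ c d : V, expect α E (fun A => ind (Disjointly
      (fun A B => LinkedTo A T c ∧ Linked B d v) A)) ≤
      proxTo α E T c * expect α E fun A => ind (Linked A d v) := by
    intro c d
    refine (expect_disjointly_le h0 h1 _ fun A A' B B' hA hB h => ⟨h.1.mono hA, h.2.mono hB⟩).trans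
      (le_of_eq ?_)
    simp only [ind_and, expect_const_mul, expect_mul_const, proxTo]
  have harris : proxTo α E T a * expect α E (fun A => ind (Linked A a v)) ≤ proxTo α E T v := by
    refine (expect_mul_expect_le h0 h1 (monotone_linkedTo T a) (monotone_linked a v)).trans ?_
    refine expect_mono h0 h1 fun A _ => ?_
    rw [← ind_and]
    exact ind_mono fun h => h.1.trans h.2
  have hopen : expect α E (fun A => ind (LinkedTo (insert s(a, b) A) T v)) ≤ proxTo α E T v +
      (proxTo α E T a * expect α E (fun A => ind (Linked A b v)) +
        proxTo α E T b * expect α E (fun A => ind (Linked A a v))) := by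
    refine le_trans ?_ (add_le_add_right (add_le_add (bk a b) (bk b a)) _)
    unfold proxTo
    rw [← expect_add, ← expect_add]
    refine expect_mono h0 h1 fun A _ => ?_
    refine le_trans (ind_mono ?_) ((ind_or_le _ _).trans (add_le_add_right (ind_or_le _ _) _))
    intro h
    by_cases hn : LinkedTo A T v
    · exact Or.inl hn
    · obtain ⟨t, ht, h⟩ := h
      rcases h.of_insert with h | ⟨h, h'⟩ | ⟨h, h'⟩
      · exact Or.inl ⟨t, ht, h⟩
      · exact Or.inr (Or.inl (LinkedTo.disjointly hn ⟨t, ht, h⟩ h'))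
      · exact Or.inr (Or.inr (LinkedTo.disjointly hn ⟨t, ht, h⟩ h'))
  have hT : proxTo α E T v ≤ proxTo α E (insert b T) v :=
    expect_mono h0 h1 fun A _ => ind_mono fun ⟨t, ht, h⟩ => ⟨t, Finset.mem_insert_of_mem ht, h⟩
  have hb : expect α E (fun A => ind (Linked A b v)) ≤ proxTo α E (insert b T) v :=
    expect_mono h0 h1 fun A _ => ind_mono fun h => ⟨b, Finset.mem_insert_self b T, h⟩
  have hnn : ∀ c, 0 ≤ expect α E (fun A => ind (Linked A c v)) :=
    fun c => expect_nonneg h0 h1 fun A => ind_nonneg _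
  have hTn : ∀ v, 0 ≤ proxTo α E T v := fun v => expect_nonneg h0 h1 fun A => ind_nonneg _
  have hTa : proxTo α E T a ≤ 1 := by
    have := expect_mono (E := E) (g := fun _ => 1) h0 h1 fun A _ => ind_le_one (LinkedTo A T a)
    rwa [expect_const] at this
  have m1 := mul_le_mul_of_nonneg_right hab (hnn a)
  have m2 := mul_le_mul_of_nonneg_right hTa (hnn b)
  have hsum : expect α E (fun A => ind (LinkedTo (insert s(a, b) A) T v)) ≤
      3 * proxTo α E (insert b T) v := by linarith
  unfold proxTo at hsum hT ⊢
  rw [expect_insert he]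
  have := hTn v
  unfold proxTo at this
  have k1 := mul_le_mul_of_nonneg_left hsum h0
  have k2 := mul_le_mul_of_nonneg_left hT (sub_nonneg.2 h1)
  nlinarith

/-- The edges of `F` are traded one at a time for an endpoint added to `T`. Which endpoint is taken
depends on the current `T` and on the edges still present. -/
theorem exists_proxTo_union_le (h0 : 0 ≤ α) (h1 : α ≤ 1) (T : Finset V) (hd : Disjoint E F) :
    ∃ T' : Finset V, T ⊆ T' ∧ T'.card ≤ T.card + F.card ∧
      ∀ v, proxTo α (E ∪ F) T v ≤ 3 ^ F.card * proxTo α E T' v := by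
  induction F using Finset.induction_on generalizing T with
  | empty => exact ⟨T, subset_rfl, by simp, by simp⟩
  | insert e F he ih =>
    rw [Finset.disjoint_insert_right] at hd
    have he' : e ∉ E ∪ F := by simp [he, hd.1]
    obtain ⟨b, hb⟩ : ∃ b, ∀ v, proxTo α (insert e (E ∪ F)) T v ≤
        3 * proxTo α (E ∪ F) (insert b T) v := by
      induction e using Sym2.inductionOn with
      | _ x y =>
        rcases le_total (proxTo α (E ∪ F) T y) (proxTo α (E ∪ F) T x) with h | h
        · exact ⟨y, proxTo_insert_le h0 h1 he' h⟩
        · refine ⟨x, fun v => ?_⟩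
          rw [Sym2.eq_swap] at he' ⊢
          exact proxTo_insert_le h0 h1 he' h v
    obtain ⟨T', hT, hc, h⟩ := ih (insert b T) hd.2
    refine ⟨T', (Finset.subset_insert _ _).trans hT, ?_, fun v => ?_⟩
    · rw [Finset.card_insert_of_notMem he]
      have := Finset.card_insert_le b T
      omega
    · rw [Finset.union_insert, Finset.card_insert_of_notMem he, pow_succ]
      have := h v
      have := hb v
      linarith

/-- Up to its first edge from `F`, a path from `u` stays within `E`. -/
theorem Linked.first_crossing (hA : A ⊆ E ∪ F) (h : Linked A u v) :
    Linked (A ∩ E) u v ∨ ∃ e ∈ F, e ∈ A ∧ ∃ x ∈ e, Linked (A ∩ E) u x := by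
  refine Linked.induction (P := fun v => Linked (A ∩ E) u v ∨
    ∃ e ∈ F, e ∈ A ∧ ∃ x ∈ e, Linked (A ∩ E) u x) (Or.inl (Linked.refl _ u)) ?_ h
  rintro a b - hab (ih | ih)
  · rcases Finset.mem_union.1 (hA hab) with hE | hF
    · exact Or.inl (ih.trans (.of_mem (Finset.mem_inter.2 ⟨hab, hE⟩)))
    · exact Or.inr ⟨_, hF, hab, a, by simp, ih⟩
  · exact Or.inr ih

/-- Union bound over the first edge of `F` on the connection: that edge is open with probability
`α`, independently of `E`, and one of its two endpoints is reached from `u` within `E`, with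
probability at most `2 * M`. -/
theorem expect_linked_union_le (h0 : 0 ≤ α) (h1 : α ≤ 1) (hd : Disjoint E F) {M : ℝ}
    (hv : expect α E (fun A => ind (Linked A u v)) ≤ M)
    (hM : ∀ e ∈ F, ∀ x ∈ e, expect α E (fun A => ind (Linked A u x)) ≤ M) :
    expect α (E ∪ F) (fun A => ind (Linked A u v)) ≤ (1 + 2 * F.card * α) * M := by
  have key : expect α (E ∪ F) (fun A => ind (Linked A u v)) ≤
      expect α (E ∪ F) (fun A => ind (Linked (A ∩ E) u v) +
        ∑ e ∈ F, ind (e ∈ A) * ind (∃ x ∈ e, Linked (A ∩ E) u x)) := by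
    refine expect_mono h0 h1 fun A hA => ?_
    have hnn : ∀ e ∈ F, 0 ≤ ind (e ∈ A) * ind (∃ x ∈ e, Linked (A ∩ E) u x) :=
      fun e _ => mul_nonneg (ind_nonneg _) (ind_nonneg _)
    by_cases h : Linked A u v
    · rw [ind_of h]
      rcases h.first_crossing hA with h | ⟨e, he, heA, hx⟩
      · rw [ind_of h]
        linarith [Finset.sum_nonneg hnn]
      · have := Finset.single_le_sum hnn he
        simp only [ind_of heA, ind_of hx] at this
        linarith [ind_nonneg (Linked (A ∩ E) u v)]
    · rw [ind_of_not h]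
      exact add_nonneg (ind_nonneg _) (Finset.sum_nonneg hnn)
  refine key.trans ?_
  rw [expect_add, expect_sum, expect_union (f := fun A => ind (Linked A u v)) hd]
  have hterm : ∀ e ∈ F, expect α (E ∪ F)
      (fun A => ind (e ∈ A) * ind (∃ x ∈ e, Linked (A ∩ E) u x)) ≤ α * (2 * M) := by
    intro e he
    rw [expect_union_mem (f := fun A => ind (∃ x ∈ e, Linked A u x)) hd he]
    refine mul_le_mul_of_nonneg_left ?_ h0
    induction e using Sym2.inductionOn with
    | _ x y =>
      have hx := hM _ he x (by simp)
      have hy := hM _ he y (by simp)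
      have : expect α E (fun A => ind (∃ z ∈ s(x, y), Linked A u z)) ≤
          expect α E (fun A => ind (Linked A u x) + ind (Linked A u y)) := by
        refine expect_mono h0 h1 fun A _ => le_trans (ind_mono ?_) (ind_or_le _ _)
        rintro ⟨z, hz, h⟩
        rcases Sym2.mem_iff.1 hz with rfl | rfl
        · exact Or.inl h
        · exact Or.inr h
      rw [expect_add] at this
      linarith
  have := Finset.sum_le_sum hterm
  rw [Finset.sum_const, nsmul_eq_mul] at this
  nlinarith

end Connection

end InfoGraph
-- Proximity and broadcast; existence of good centres.
namespace InfoGraph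

theorem le_addEdges {V : Type*} (G : SimpleGraph V) (F : Finset (Sym2 V)) : G ≤ addEdges G F := le_sup_left

theorem addEdges_empty {V : Type*} (G : SimpleGraph V) : addEdges G ∅ = G := by simp [addEdges]

section Proximity
open scoped Classical

variable {V : Type*} [Fintype V] {G H : SimpleGraph V} {α : ℝ} {u v w : V}

/-- The edges of `G`. -/
noncomputable def edges (G : SimpleGraph V) : Finset (Sym2 V) := G.edgeFinset

theorem mem_edges {e : Sym2 V} : e ∈ edges G ↔ e ∈ G.edgeSet := SimpleGraph.mem_edgeFinset

theorem coe_edges : (edges G : Set (Sym2 V)) = G.edgeSet := by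
  ext e; exact mem_edges

theorem prox_eq_expect (G : SimpleGraph V) (α : ℝ) (u v : V) :
    prox G α u v = expect α (edges G) fun A => ind (Linked A u v) := by
  unfold prox expect edges
  refine Finset.sum_congr rfl fun A hA => ?_
  rw [Finset.card_sdiff_of_subset (Finset.mem_powerset.1 hA)]
  by_cases h : (SimpleGraph.fromEdgeSet (A : Set (Sym2 V))).Reachable u v <;>
    simp [ind, Linked, h]

theorem prox_nonneg (h0 : 0 ≤ α) (h1 : α ≤ 1) (u v : V) : 0 ≤ prox G α u v := by
  rw [prox_eq_expect]
  exact expect_nonneg h0 h1 fun _ => ind_nonneg _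

theorem prox_le_one (h0 : 0 ≤ α) (h1 : α ≤ 1) (u v : V) : prox G α u v ≤ 1 := by
  rw [prox_eq_expect, ← expect_const (α := α) (E := edges G) 1]
  exact expect_mono h0 h1 fun _ _ => ind_le_one _

theorem prox_self (G : SimpleGraph V) (α : ℝ) (u : V) : prox G α u u = 1 := by
  rw [prox_eq_expect, ← expect_const (α := α) (E := edges G) 1]
  simp only [ind_of (Linked.refl _ u)]

theorem prox_comm (G : SimpleGraph V) (α : ℝ) (u v : V) : prox G α u v = prox G α v u := by
  rw [prox_eq_expect, prox_eq_expect]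
  congr 1
  ext A
  exact le_antisymm (ind_mono Linked.symm) (ind_mono Linked.symm)

/-- This is the triangle inequality for the implied metric. -/
theorem prox_mul_prox_le (h0 : 0 ≤ α) (h1 : α ≤ 1) (u v w : V) :
    prox G α u v * prox G α v w ≤ prox G α u w := by
  simp only [prox_eq_expect]
  refine (expect_mul_expect_le h0 h1 (monotone_linked u v) (monotone_linked v w)).trans ?_
  refine expect_mono h0 h1 fun A _ => ?_
  rw [← ind_and]
  exact ind_mono fun h => h.1.trans h.2

theorem prox_mono (h0 : 0 ≤ α) (h1 : α ≤ 1) (h : G ≤ H) (u v : V) :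
    prox G α u v ≤ prox H α u v := by
  simp only [prox_eq_expect]
  refine expect_le_of_subset h0 h1 (monotone_linked u v) fun e he => ?_
  exact mem_edges.2 (SimpleGraph.edgeSet_mono h (mem_edges.1 he))

theorem prox_pos (hG : G.Connected) (h0 : 0 < α) (h1 : α ≤ 1) (u v : V) : 0 < prox G α u v := by
  rw [prox_eq_expect]
  refine expect_pos h0 h1 (fun _ => ind_nonneg _) ?_
  rw [ind_of]
  · exact one_pos
  · unfold Linked
    rw [coe_edges, SimpleGraph.fromEdgeSet_edgeSet]
    exact hG.preconnected u v

theorem prox_lt_one (h0 : 0 ≤ α) (h1 : α < 1) (huv : u ≠ v) : prox G α u v < 1 := by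
  rw [prox_eq_expect]
  refine expect_lt_one h0 h1 (fun _ => ind_le_one _) (ind_of_not fun h => huv ?_)
  refine Linked.induction (P := fun v => u = v) rfl ?_ h
  intro a b _ h
  simp at h

theorem le_prox_of_adj (h0 : 0 ≤ α) (h1 : α ≤ 1) (h : G.Adj u v) : α ≤ prox G α u v := by
  rw [prox_eq_expect]
  have hs : insert s(u, v) ∅ ⊆ edges G := by
    intro e he
    rw [insert_empty_eq, Finset.mem_singleton] at he
    subst he
    exact mem_edges.2 h
  refine le_trans ?_ (expect_le_of_subset h0 h1 (monotone_linked u v) hs)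
  rw [expect_insert (Finset.notMem_empty _), expect_empty, expect_empty, ind_of]
  · have := mul_nonneg (sub_nonneg.2 h1) (ind_nonneg (Linked ∅ u v))
    linarith
  · exact Linked.of_mem (Finset.mem_insert_self _ _)

theorem prox_eq_one (u v : V) (hG : G.Connected) : prox G 1 u v = 1 := by
  refine le_antisymm (prox_le_one zero_le_one le_rfl u v) ?_
  obtain ⟨p⟩ := hG.preconnected u v
  induction p with
  | nil => rw [prox_self]
  | @cons x y z h p ih =>
    have h1 := le_prox_of_adj zero_le_one (le_refl (1 : ℝ)) h
    refine le_trans ?_ (prox_mul_prox_le zero_le_one le_rfl x y z)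
    exact one_le_mul_of_one_le_of_one_le h1 ih

theorem broadcast_le (h0 : 0 ≤ α) (h1 : α ≤ 1) (u v : V) : broadcast G α ≤ prox G α u v :=
  ciInf_le (f := fun p : V × V => prox G α p.1 p.2)
    ⟨0, by rintro _ ⟨p, rfl⟩; exact prox_nonneg h0 h1 _ _⟩ (u, v)

theorem le_broadcast [Nonempty V] {c : ℝ} (h : ∀ u v, c ≤ prox G α u v) : c ≤ broadcast G α :=
  le_ciInf fun p => h p.1 p.2

theorem broadcast_le_one [Nonempty V] (h0 : 0 ≤ α) (h1 : α ≤ 1) : broadcast G α ≤ 1 :=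
  let v := Classical.arbitrary V
  (broadcast_le h0 h1 v v).trans (prox_le_one h0 h1 v v)

theorem broadcast_pos (hG : G.Connected) (h0 : 0 < α) (h1 : α ≤ 1) : 0 < broadcast G α := by
  have := hG.nonempty
  obtain ⟨p, hp⟩ := exists_eq_ciInf_of_finite (f := fun p : V × V => prox G α p.1 p.2)
  unfold broadcast
  rw [← hp]
  exact prox_pos hG h0 h1 _ _

theorem edges_addEdges {F : Finset (Sym2 V)} (hF : (F : Set (Sym2 V)) ⊆ Gᶜ.edgeSet) :
    edges (addEdges G F) = edges G ∪ F := by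
  ext e
  rw [mem_edges, addEdges, SimpleGraph.edgeSet_sup, SimpleGraph.edgeSet_fromEdgeSet,
    Finset.mem_union, mem_edges]
  constructor
  · rintro (h | h)
    · exact Or.inl h
    · exact Or.inr h.1
  · rintro (h | h)
    · exact Or.inl h
    · exact Or.inr ⟨h, SimpleGraph.not_isDiag_of_mem_edgeSet _ (hF h)⟩

theorem disjoint_edges {F : Finset (Sym2 V)} (hF : (F : Set (Sym2 V)) ⊆ Gᶜ.edgeSet) :
    Disjoint (edges G) F := by
  rw [Finset.disjoint_left]
  intro e he heF
  have h := hF heF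
  have h' := mem_edges.1 he
  induction e using Sym2.inductionOn with
  | _ x y =>
    rw [SimpleGraph.mem_edgeSet, SimpleGraph.compl_adj] at h
    exact h.2 h'

theorem exists_optBroadcast_eq (G : SimpleGraph V) (α : ℝ) (k : ℕ) :
    ∃ F : Finset (Sym2 V), (F : Set (Sym2 V)) ⊆ Gᶜ.edgeSet ∧ F.card ≤ k ∧
      optBroadcast G α k = broadcast (addEdges G F) α := by
  refine Set.Nonempty.csSup_mem (s := {b : ℝ | ∃ F : Finset (Sym2 V),
    (F : Set (Sym2 V)) ⊆ Gᶜ.edgeSet ∧ F.card ≤ k ∧ b = broadcast (addEdges G F) α})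
    ⟨_, ∅, by simp, by simp, rfl⟩ ?_
  refine (Set.finite_range fun F : Finset (Sym2 V) => broadcast (addEdges G F) α).subset ?_
  rintro _ ⟨F, -, -, rfl⟩
  exact ⟨F, rfl⟩

theorem optBroadcast_pos (hG : G.Connected) (h0 : 0 < α) (h1 : α ≤ 1) (k : ℕ) :
    0 < optBroadcast G α k := by
  obtain ⟨F, -, -, h⟩ := exists_optBroadcast_eq G α k
  rw [h]
  exact broadcast_pos (hG.mono (le_addEdges G F)) h0 h1

theorem optBroadcast_le_one [Nonempty V] (h0 : 0 ≤ α) (h1 : α ≤ 1) (k : ℕ) :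
    optBroadcast G α k ≤ 1 := by
  obtain ⟨F, -, -, h⟩ := exists_optBroadcast_eq G α k
  rw [h]
  exact broadcast_le_one h0 h1

theorem optBroadcast_zero (G : SimpleGraph V) (α : ℝ) : optBroadcast G α 0 = broadcast G α := by
  obtain ⟨F, -, hF, h⟩ := exists_optBroadcast_eq G α 0
  rw [h, Finset.card_eq_zero.1 (Nat.le_zero.1 hF), addEdges_empty]

/-- The centres are the endpoints of an optimal set of edges. For given `u`, the bound on first
crossings is applied to the endpoint `s` closest to `u`, so that `M = prox G α u s` dominates the
proximity to every endpoint. -/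
theorem exists_centres_two_mul [Nonempty V] (h0 : 0 ≤ α) (h1 : α ≤ 1) {k : ℕ} (hk : 0 < k) :
    ∃ S : Finset V, S.Nonempty ∧ S.card ≤ 2 * k ∧
      ∀ u, ∃ s ∈ S, optBroadcast G α k / (1 + 2 * k * α) ≤ prox G α u s := by
  obtain ⟨F, hF, hFk, hopt⟩ := exists_optBroadcast_eq G α k
  obtain ⟨S, hne, hcard, hS⟩ : ∃ S : Finset V, S.Nonempty ∧ S.card ≤ 2 * k ∧
      ∀ e ∈ F, ∀ x ∈ e, x ∈ S := by
    rcases F.eq_empty_or_nonempty with rfl | ⟨e, he⟩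
    -- Without new edges any single vertex serves; this needs `1 ≤ 2 * k`.
    · exact ⟨{Classical.arbitrary V}, by simp, by simp; omega, by simp⟩
    · refine ⟨F.biUnion Sym2.toFinset, ?_, ?_, ?_⟩
      · induction e using Sym2.inductionOn with
        | _ x y => exact ⟨x, Finset.mem_biUnion.2 ⟨_, he, by simp⟩⟩
      · refine (Finset.card_biUnion_le_card_mul F _ 2 fun e _ => ?_).trans (by omega)
        induction e using Sym2.inductionOn with
        | _ x y => exact (Sym2.card_toFinset _).trans_le (by split_ifs <;> omega)
      · intro e he x hx
        exact Finset.mem_biUnion.2 ⟨e, he, by simpa using hx⟩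
  refine ⟨S, hne, hcard, fun u => ?_⟩
  obtain ⟨s, hs, hmax⟩ := Finset.exists_max_image S (fun s => prox G α u s) hne
  refine ⟨s, hs, ?_⟩
  have key := expect_linked_union_le (u := u) (v := s) h0 h1 (disjoint_edges hF)
    (M := prox G α u s) (prox_eq_expect G α u s).ge
    (fun e he x hx => (prox_eq_expect G α u x).ge.trans (hmax x (hS e he x hx)))
  rw [← edges_addEdges hF, ← prox_eq_expect] at key
  have hb := broadcast_le (G := addEdges G F) h0 h1 u s
  have hk' : (F.card : ℝ) ≤ k := by exact_mod_cast hFk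
  rw [hopt, div_le_iff₀ (by positivity), mul_comm]
  refine hb.trans (key.trans (mul_le_mul_of_nonneg_right ?_ (prox_nonneg h0 h1 _ _)))
  gcongr

/-- All optimal edges are traded for centres, starting from one arbitrary vertex. A union bound over
at most `k + 1` centres then turns connection to the set into proximity to its closest member. -/
theorem exists_centres_succ [Nonempty V] (h0 : 0 ≤ α) (h1 : α ≤ 1) (k : ℕ) :
    ∃ S : Finset V, S.Nonempty ∧ S.card ≤ k + 1 ∧
      ∀ u, ∃ s ∈ S, optBroadcast G α k / (3 ^ k * (k + 1)) ≤ prox G α u s := by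
  obtain ⟨F, hF, hFk, hopt⟩ := exists_optBroadcast_eq G α k
  let v := Classical.arbitrary V
  obtain ⟨S, hne, hcard, hS⟩ := exists_proxTo_union_le h0 h1 {v} (disjoint_edges hF)
  rw [Finset.card_singleton] at hcard
  have hne' : S.Nonempty := ⟨v, hne (by simp)⟩
  refine ⟨S, hne', by omega, fun u => ?_⟩
  obtain ⟨s, hs, hmax⟩ := Finset.exists_max_image S (fun s => prox G α u s) hne'
  refine ⟨s, hs, ?_⟩
  have e : proxTo α (edges G ∪ F) {v} u = prox (addEdges G F) α v u := by
    rw [prox_eq_expect, edges_addEdges hF]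
    simp [proxTo, LinkedTo]
  have hsum : proxTo α (edges G) S u ≤ ∑ t ∈ S, prox G α u t := by
    simp only [prox_eq_expect]
    rw [← expect_sum]
    refine expect_mono h0 h1 fun A _ => ?_
    by_cases h : LinkedTo A S u
    · obtain ⟨t, ht, hl⟩ := h
      rw [ind_of ⟨t, ht, hl⟩, ← ind_of hl.symm]
      exact Finset.single_le_sum (f := fun t => ind (Linked A u t)) (fun _ _ => ind_nonneg _) ht
    · rw [ind_of_not h]
      exact Finset.sum_nonneg fun _ _ => ind_nonneg _
  have hsum' := hsum.trans (Finset.sum_le_card_nsmul S _ _ hmax)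
  rw [nsmul_eq_mul] at hsum'
  have hb := (broadcast_le (G := addEdges G F) h0 h1 v u).trans (e ▸ hS u)
  have hn := prox_nonneg (G := G) h0 h1 u s
  have c1 : (S.card : ℝ) ≤ k + 1 := by exact_mod_cast hcard.trans (by omega)
  have c2 : (3 : ℝ) ^ F.card ≤ 3 ^ k := pow_le_pow_right₀ (by norm_num) hFk
  rw [hopt, div_le_iff₀ (by positivity), mul_comm]
  calc _ ≤ _ := hb
    _ ≤ 3 ^ F.card * (S.card * prox G α u s) := by gcongr
    _ = 3 ^ F.card * S.card * prox G α u s := by ring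
    _ ≤ 3 ^ k * (k + 1) * prox G α u s := by gcongr

/-- A star on centres of coverage `x` has broadcast at least `x ^ 2 * α ^ 2`. -/
theorem le_broadcast_of_star [Nonempty V] (h0 : 0 ≤ α) (h1 : α ≤ 1) {x : ℝ} (hx : 0 ≤ x) (hGH : G ≤ H)
    (r : V) (h : ∀ u, ∃ c, x ≤ prox G α u c ∧ (c = r ∨ H.Adj r c)) :
    x ^ 2 * α ^ 2 ≤ broadcast H α := by
  have key : ∀ u, x * α ≤ prox H α u r := by
    intro u
    obtain ⟨c, hc, hr⟩ := h u
    have hcr : α ≤ prox H α c r := by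
      rcases hr with rfl | hr
      · rw [prox_self]; exact h1
      · exact le_prox_of_adj h0 h1 hr.symm
    exact (mul_le_mul (hc.trans (prox_mono h0 h1 hGH u c)) hcr h0 (prox_nonneg h0 h1 _ _)).trans
      (prox_mul_prox_le h0 h1 u c r)
  refine le_broadcast fun u v => ?_
  have := mul_le_mul (key u) (key v) (by positivity) (prox_nonneg h0 h1 _ _)
  rw [prox_comm H α v r] at this
  calc x ^ 2 * α ^ 2 = x * α * (x * α) := by ring
    _ ≤ _ := this.trans (prox_mul_prox_le h0 h1 u r v)

end Proximity

/-! ### Doubling dimension. -/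

section Doubling

variable {V : Type*} {ρ : V → V → ℝ}

theorem doublingDim_nonneg [Nonempty V] (h : ∀ x, ρ x x = 0) : 0 ≤ doublingDim ρ := by
  refine Real.sInf_nonneg fun d hd => ?_
  obtain ⟨S, hS, hc⟩ := hd 1 one_pos (Classical.arbitrary V)
  have hmem := hc (show Classical.arbitrary V ∈ {y | ρ (Classical.arbitrary V) y ≤ 1} by simp [h])
  simp only [Set.mem_iUnion] at hmem
  obtain ⟨c, hcS, -⟩ := hmem
  have : (1 : ℝ) ≤ S.card := by exact_mod_cast Finset.card_pos.2 ⟨c, hcS⟩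
  by_contra hneg
  exact absurd (this.trans hS) (not_le.2 (Real.rpow_lt_one_of_one_lt_of_neg (by norm_num)
    (not_le.1 hneg)))

variable [Fintype V]

/-- The infimum in the definition of the doubling dimension is attained. -/
theorem doublingDim_spec [Nonempty V] (h : ∀ x, ρ x x = 0) {r : ℝ} (hr : 0 < r) (x : V) :
    ∃ S : Finset V, (S.card : ℝ) ≤ (2 : ℝ) ^ doublingDim ρ ∧
      {y | ρ x y ≤ r} ⊆ ⋃ c ∈ S, {y | ρ c y ≤ r / 2} := by
  set d := doublingDim ρ with hd
  have hpos : (0 : ℝ) < 2 ^ d := by positivity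
  -- Cardinalities are integers: a dimension slightly above `d` still admits no cover size beyond
  -- `⌊2 ^ d⌋`.
  have hlt : d < Real.logb 2 (⌊(2 : ℝ) ^ d⌋₊ + 1) := by
    rw [Real.lt_logb_iff_rpow_lt (by norm_num) (by positivity)]
    exact Nat.lt_floor_add_one _
  have hne : {d : ℝ | ∀ r : ℝ, 0 < r → ∀ x : V, ∃ S : Finset V, (S.card : ℝ) ≤ (2 : ℝ) ^ d ∧
      {y | ρ x y ≤ r} ⊆ ⋃ c ∈ S, {y | ρ c y ≤ r / 2}}.Nonempty := by
    refine ⟨Real.logb 2 (Fintype.card V), fun r hr x => ⟨Finset.univ, ?_, ?_⟩⟩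
    · rw [Real.rpow_logb (by norm_num) (by norm_num) (by exact_mod_cast Fintype.card_pos)]
      simp
    · intro y _
      simp only [Set.mem_iUnion, Set.mem_ofPred_eq]
      exact ⟨y, Finset.mem_univ y, by rw [h]; positivity⟩
  obtain ⟨d', hd', hlt'⟩ := exists_lt_of_csInf_lt hne hlt
  obtain ⟨S, hS, hc⟩ := hd' r hr x
  refine ⟨S, ?_, hc⟩
  rw [Real.lt_logb_iff_rpow_lt (by norm_num) (by positivity)] at hlt'
  have h1 : (S.card : ℝ) < (⌊(2 : ℝ) ^ d⌋₊ : ℝ) + 1 := hS.trans_lt hlt'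
  have h2 : S.card < ⌊(2 : ℝ) ^ d⌋₊ + 1 := by exact_mod_cast h1
  calc (S.card : ℝ) ≤ (⌊(2 : ℝ) ^ d⌋₊ : ℝ) := by exact_mod_cast Nat.lt_succ_iff.1 h2
    _ ≤ _ := Nat.floor_le hpos.le

theorem exists_cover_pow [Nonempty V] (h : ∀ x, ρ x x = 0) {r : ℝ} (hr : 0 < r) (x : V) (i : ℕ) :
    ∃ S : Finset V, (S.card : ℝ) ≤ ((2 : ℝ) ^ doublingDim ρ) ^ i ∧
      {y | ρ x y ≤ r} ⊆ ⋃ c ∈ S, {y | ρ c y ≤ r / 2 ^ i} := by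
  classical
  induction i with
  | zero => exact ⟨{x}, by simp, by simp⟩
  | succ i ih =>
    obtain ⟨S, hS, hc⟩ := ih
    choose T hT hTc using fun c => doublingDim_spec h (r := r / 2 ^ i) (by positivity) c
    refine ⟨S.biUnion T, ?_, fun y hy => ?_⟩
    · calc ((S.biUnion T).card : ℝ) ≤ ∑ c ∈ S, ((T c).card : ℝ) := by
            exact_mod_cast Finset.card_biUnion_le
        _ ≤ S.card • (2 : ℝ) ^ doublingDim ρ := Finset.sum_le_card_nsmul _ _ _ fun c _ => hT c
        _ ≤ _ := by rw [nsmul_eq_mul, pow_succ]; gcongr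
    · have := hc hy
      simp only [Set.mem_iUnion, Set.mem_ofPred_eq] at this
      obtain ⟨c, hcS, hcy⟩ := this
      have := hTc c hcy
      simp only [Set.mem_iUnion, Set.mem_ofPred_eq] at this ⊢
      obtain ⟨z, hz, hzy⟩ := this
      refine ⟨z, Finset.mem_biUnion.2 ⟨c, hcS, hz⟩, hzy.trans (le_of_eq ?_)⟩
      rw [pow_succ, div_div]

/-- A space with two points and distinct points at positive distance has doubling dimension at
least `1`. -/
theorem one_le_doublingDim [Nontrivial V] (h : ∀ x, ρ x x = 0)
    (hpos : ∀ x y, x ≠ y → 0 < ρ x y) : 1 ≤ doublingDim ρ := by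
  classical
  obtain ⟨a, b, hab⟩ := exists_pair_ne V
  -- At the smallest positive distance as radius, balls of half the radius are singletons.
  obtain ⟨p, hp, hmin⟩ := Finset.exists_min_image
    (Finset.univ.filter fun p : V × V => p.1 ≠ p.2) (fun p => ρ p.1 p.2) ⟨(a, b), by simpa⟩
  simp only [Finset.mem_filter, Finset.mem_univ, true_and] at hp hmin
  have hr := hpos _ _ hp
  obtain ⟨S, hS, hc⟩ := doublingDim_spec h hr p.1
  have hcov : ∀ y, ρ p.1 y ≤ ρ p.1 p.2 → y ∈ S := by
    intro y hy
    have := hc hy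
    simp only [Set.mem_iUnion, Set.mem_ofPred_eq] at this
    obtain ⟨c, hcS, hcy⟩ := this
    by_cases hne : c = y
    · exact hne ▸ hcS
    · have := hmin (c, y) hne
      simp only at this
      linarith
  have h2 : ({p.1, p.2} : Finset V) ⊆ S := by
    intro y hy
    rcases Finset.mem_insert.1 hy with rfl | hy
    · exact hcov _ (by rw [h]; exact hr.le)
    · rw [Finset.mem_singleton.1 hy]
      exact hcov _ le_rfl
  have h3 : (2 : ℝ) ≤ S.card := by
    have := Finset.card_le_card h2
    rw [Finset.card_pair hp] at this
    exact_mod_cast this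
  have h4 : (2 : ℝ) ^ (1 : ℝ) ≤ 2 ^ doublingDim ρ := by
    rw [Real.rpow_one]; exact h3.trans hS
  exact (Real.rpow_le_rpow_left_iff (by norm_num)).1 h4

end Doubling

end InfoGraph
-- Correctness: size of the net, quality of the best tuple, the output.
namespace InfoGraph
open RealRAM

section
variable {n : ℕ} {G : SimpleGraph (Fin n)} {α : ℝ}

theorem graphOracle_prox {u v : ℕ} (hu : u < n) (hv : v < n) :
    (graphOracle G α).prox u v = prox G α ⟨u, hu⟩ ⟨v, hv⟩ := dif_pos ⟨hu, hv⟩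

theorem graphOracle_adj_eq_zero {u v : ℕ} (hu : u < n) (hv : v < n) :
    (graphOracle G α).adj u v = 0 ↔ ¬ G.Adj ⟨u, hu⟩ ⟨v, hv⟩ := by
  simp [graphOracle, hu, hv]

theorem graphOracle_bounded (G : SimpleGraph (Fin n)) (h0 : 0 ≤ α) (h1 : α ≤ 1) :
    (graphOracle G α).Bounded where
  nonneg u v := by
    unfold graphOracle
    dsimp only
    split_ifs
    · exact prox_nonneg h0 h1 _ _
    · exact le_rfl
  le_one u v := by
    unfold graphOracle
    dsimp only
    split_ifs
    · exact prox_le_one h0 h1 _ _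
    · exact zero_le_one

theorem impliedDist_self (G : SimpleGraph (Fin n)) (α : ℝ) (u : Fin n) :
    impliedDist G α u u = 0 := by simp [impliedDist, prox_self]

theorem impliedDist_le_iff (hG : G.Connected) (h0 : 0 < α) (h1 : α ≤ 1) (u v : Fin n) (r : ℝ) :
    impliedDist G α u v ≤ r ↔ (2 : ℝ) ^ (-r) ≤ prox G α u v := by
  unfold impliedDist
  rw [neg_le, Real.le_logb_iff_rpow_le (by norm_num) (prox_pos hG h0 h1 u v)]

/-- The size of a net in terms of the doubling dimension. -/
theorem IsNet.card_le (hG : G.Connected) (h0 : 0 < α) (h1 : α ≤ 1) {m j N : ℕ} {A : ℕ → ℕ} {qm : ℝ}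
    (hm : 0 < m) (h : IsNet (graphOracle G α).prox n m (2 ^ j) A N qm) :
    (N : ℝ) ≤ m * ((2 : ℝ) ^ doublingDim (impliedDist G α)) ^ (j + 1) := by
  have := hG.nonempty
  set d := doublingDim (impliedDist G α) with hd
  have hd0 : 0 ≤ d := doublingDim_nonneg (impliedDist_self G α)
  have hD : (1 : ℝ) ≤ 2 ^ d := Real.one_le_rpow (by norm_num) hd0
  rcases h.le.eq_or_lt with rfl | hlt
  · exact le_mul_of_one_le_right (Nat.cast_nonneg _) (one_le_pow₀ hD)
  obtain ⟨q, hq, hsp⟩ : ∃ q, q ^ 2 ^ j < qm ∧ Spread (graphOracle G α).prox A N q :=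
    h.sep.resolve_left hlt.ne'
  obtain ⟨v, hcov⟩ := h.coverage
  have hqm0 : 0 < qm := by
    refine lt_of_lt_of_le ?_ (hcov.le 0 hm)
    rw [graphOracle_prox hcov.lt (h.lt 0 (by omega))]
    exact prox_pos hG h0 h1 _ _
  -- The point after the first `m` has proximity at least `qm` to one of them, but at most `q` by
  -- separation. This also forces `q < 1`, since otherwise `q ≤ q ^ 2 ^ j < qm`.
  have hqmq : qm ≤ q := by
    obtain ⟨i, hi, hi'⟩ := hcov.cover hm (A m) (h.lt m hlt)
    exact hi'.trans (hsp m hlt i hi)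
  have hq1 : q < 1 := by
    by_contra hge
    have := le_self_pow₀ (not_lt.1 hge) (pow_ne_zero j two_ne_zero)
    linarith
  have hr : 0 < -Real.logb 2 qm := by
    have := Real.logb_neg (b := 2) (by norm_num) hqm0 (hqmq.trans_lt hq1)
    linarith
  have hlt' : ∀ i : Fin N, A i < n := fun i => h.lt i i.2
  choose S hS hSc using fun x => exists_cover_pow (impliedDist_self G α) hr x (j + 1)
  have hex : ∀ i : Fin N, ∃ a : Fin m, ∃ c ∈ S ⟨A a, h.lt a (a.2.trans hlt)⟩,
      impliedDist G α c ⟨A i, hlt' i⟩ ≤ -Real.logb 2 qm / 2 ^ (j + 1) := by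
    intro i
    obtain ⟨a, ha, hle⟩ := hcov.cover hm (A i) (hlt' i)
    have haN := h.lt a (ha.trans hlt)
    rw [graphOracle_prox (hlt' i) haN, prox_comm] at hle
    have hmem : impliedDist G α ⟨A a, haN⟩ ⟨A i, hlt' i⟩ ≤ -Real.logb 2 qm := by
      rw [impliedDist_le_iff hG h0 h1, neg_neg, Real.rpow_logb (by norm_num) (by norm_num) hqm0]
      exact hle
    have := hSc _ hmem
    simp only [Set.mem_iUnion, Set.mem_ofPred_eq] at this
    obtain ⟨c, hc, hcy⟩ := this
    exact ⟨⟨a, ha⟩, c, hc, hcy⟩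
  choose a c hc hdist using hex
  -- Two net points in the same small ball would have distance at most twice `r / 2 ^ (j + 1)`,
  -- where `r = -logb 2 qm`. Their proximity raised to `2 ^ j` would then be at least `qm`, against
  -- the separation.
  have hinj : Function.Injective fun i => (⟨a i, c i⟩ : Σ _ : Fin m, Fin n) := by
    have main : ∀ i i' : Fin N, i < i' → c i = c i' → False := by
      intro i i' hii hcc
      have e1 := hdist i
      have e2 := hdist i'
      rw [← hcc] at e2
      rw [impliedDist_le_iff hG h0 h1] at e1 e2
      have hle := hsp i' i'.2 i hii
      rw [graphOracle_prox (hlt' i') (hlt' i)] at hle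
      rw [prox_comm] at e2
      have hmul := (mul_le_mul e2 e1 (by positivity) (prox_nonneg h0.le h1 _ _)).trans
        ((prox_mul_prox_le h0.le h1 _ _ _).trans hle)
      rw [← Real.rpow_add (by norm_num)] at hmul
      have hpow := pow_le_pow_left₀ (by positivity) hmul (2 ^ j)
      rw [← Real.rpow_natCast, ← Real.rpow_mul (by norm_num)] at hpow
      have hexp : (-(-Real.logb 2 qm / 2 ^ (j + 1)) + -(-Real.logb 2 qm / 2 ^ (j + 1))) *
          ((2 ^ j : ℕ) : ℝ) = Real.logb 2 qm := by
        push_cast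
        rw [pow_succ]
        field_simp
        ring
      rw [hexp, Real.rpow_logb (by norm_num) (by norm_num) hqm0] at hpow
      linarith
    intro i i' hii
    have hcc : c i = c i' := by
      simp only [Sigma.mk.injEq, heq_eq_eq] at hii
      exact hii.2
    rcases lt_trichotomy i i' with hlt | he | hlt
    · exact (main i i' hlt hcc).elim
    · exact he
    · exact (main i' i hlt hcc.symm).elim
  have hcard := Finset.card_le_card_of_injOn
    (s := Finset.univ) (t := Finset.univ.sigma fun a : Fin m => S ⟨A a, h.lt a (a.2.trans hlt)⟩)
    (fun i => (⟨a i, c i⟩ : Σ _ : Fin m, Fin n))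
    (fun i _ => by simpa using hc i) hinj.injOn
  rw [Finset.card_sigma, Finset.card_univ, Fintype.card_fin] at hcard
  calc (N : ℝ) ≤ ∑ a : Fin m, ((S ⟨A a, h.lt a (a.2.trans hlt)⟩).card : ℝ) := by exact_mod_cast hcard
    _ ≤ (Finset.univ : Finset (Fin m)).card • (2 ^ d : ℝ) ^ (j + 1) :=
      Finset.sum_le_card_nsmul _ _ _ fun a _ => hS _
    _ = _ := by simp

/-- If some `m` vertices have coverage `ρ`, then the best tuple from the net has coverage almost as
good. -/
theorem rpow_le_of_isNet (h0 : 0 < α) (h1 : α ≤ 1) {m j N : ℕ} {A : ℕ → ℕ}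
    {qm bq ρ δ : ℝ} (hm : 0 < m) (h : IsNet (graphOracle G α).prox n m (2 ^ j) A N qm)
    (hN : ∃ q v, IsCoverage (graphOracle G α).prox n A N q v ∧ qm ≤ q ^ 2 ^ j)
    (hbq : ∀ c < N ^ m, ∃ v < n, ∀ i < m, (graphOracle G α).prox v (A (c / N ^ i % N)) ≤ bq)
    {S : Finset (Fin n)} (hS : S.Nonempty) (hSm : S.card ≤ m) (hρ : 0 < ρ) (hρ1 : ρ ≤ 1)
    (hcover : ∀ u, ∃ s ∈ S, ρ ≤ prox G α u s) (hδ : 2 / 2 ^ j ≤ δ) :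
    ρ ^ (1 + δ) ≤ bq := by
  obtain ⟨q, w, hq, hqmq⟩ := hN
  have hN0 : 0 < N := hm.trans_le h.le
  have hcov' : ∀ u : ℕ, ∃ s ∈ S, ∀ hu : u < n, ρ ≤ prox G α ⟨u, hu⟩ s := by
    intro u
    by_cases hu : u < n
    · obtain ⟨s, hs, hs'⟩ := hcover ⟨u, hu⟩
      exact ⟨s, hs, fun _ => hs'⟩
    · obtain ⟨s, hs⟩ := hS
      exact ⟨s, hs, fun h => absurd h hu⟩
  choose f hfS hf using hcov'
  -- Pigeonhole as for the `k`-centre problem: among the first `m` points and the vertex farthest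
  -- from them, two share a centre of `S`, so their proximity is at least `ρ ^ 2`; by spread it is
  -- at most `qm`.
  have hqm : ρ ^ 2 ≤ qm := by
    obtain ⟨v, hv⟩ := h.coverage
    have hsp := h.spread.snoc hv
    set A' := Function.update A m v with hA'
    have hlt : ∀ i < m + 1, A' i < n := by
      intro i hi
      rcases Nat.lt_succ_iff_lt_or_eq.1 hi with hi | rfl
      · rw [hA', Function.update_of_ne hi.ne]; exact h.lt i (hi.trans_le h.le)
      · rw [hA', Function.update_self]; exact hv.lt
    have main : ∀ a b, a < b → b < m + 1 → f (A' a) = f (A' b) → ρ ^ 2 ≤ qm := by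
      intro a b hab hb hfab
      have ha := hlt a (hab.trans hb)
      have hb' := hlt b hb
      have e1 := hf _ ha
      have e2 := hf _ hb'
      rw [hfab, prox_comm] at e1
      have := hsp b hb a hab
      rw [graphOracle_prox hb' ha] at this
      rw [sq]
      exact (mul_le_mul e2 e1 hρ.le (prox_nonneg h0.le h1 _ _)).trans
        ((prox_mul_prox_le h0.le h1 _ _ _).trans this)
    obtain ⟨a, ha, b, hb, hab, hfab⟩ := Finset.exists_ne_map_eq_of_card_lt_of_maps_to
      (s := Finset.range (m + 1)) (t := S) (f := fun i => f (A' i))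
      (by rw [Finset.card_range]; omega) (fun i _ => hfS _)
    rw [Finset.mem_range] at ha hb
    rcases hab.lt_or_gt with hlt | hlt
    · exact main a b hlt hb hfab
    · exact main b a hlt ha hfab.symm
  have hq0 : 0 ≤ q := ((graphOracle_bounded G h0.le h1).nonneg _ _).trans (hq.le 0 hN0)
  have hqρ : ρ ^ (2 / 2 ^ j : ℝ) ≤ q := by
    rw [← pow_le_pow_iff_left₀ (by positivity) hq0 (pow_ne_zero j two_ne_zero),
      ← Real.rpow_natCast, ← Real.rpow_mul hρ.le]
    have : (2 / 2 ^ j : ℝ) * ((2 ^ j : ℕ) : ℝ) = (2 : ℕ) := by push_cast; field_simp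
    rw [this, Real.rpow_natCast]
    exact hqm.trans hqmq
  -- The centres are listed as an `m`-tuple, with repetitions if there are fewer, and each is then
  -- rounded to a net point `t i`.
  obtain ⟨e, he⟩ : ∃ e : Fin m → Fin n, ∀ s ∈ S, ∃ i, e i = s := by
    have : Nonempty S := hS.to_subtype
    obtain ⟨g, hg⟩ := Function.Embedding.nonempty_of_card_le (α := S) (β := Fin m) (by simpa using hSm)
    refine ⟨fun i => (Function.invFun g i : S), fun s hs => ⟨g ⟨s, hs⟩, ?_⟩⟩
    exact congrArg Subtype.val (Function.leftInverse_invFun hg ⟨s, hs⟩)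
  choose t ht ht' using fun i : Fin m => hq.cover hN0 (e i) (e i).2
  -- The rounded tuple occurs in the enumeration: its number is the one with base `N` digits `t i`.
  have htup : ∀ i : Fin m,
      ((finFunctionFinEquiv fun i => (⟨t i, ht i⟩ : Fin N)) : ℕ) / N ^ (i : ℕ) % N = t i := by
    intro i
    have := finFunctionFinEquiv_symm_apply_val (finFunctionFinEquiv fun i => (⟨t i, ht i⟩ : Fin N)) i
    rw [Equiv.symm_apply_apply] at this
    exact this.symm
  obtain ⟨v, hv, hle⟩ := hbq _ (finFunctionFinEquiv fun i => (⟨t i, ht i⟩ : Fin N)).2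
  obtain ⟨i, hi⟩ := he _ (hfS v)
  have k1 := hf v hv
  have k2 := ht' i
  have k3 := hle i i.2
  rw [htup, graphOracle_prox hv (h.lt _ (ht i))] at k3
  rw [graphOracle_prox (e i).2 (h.lt _ (ht i))] at k2
  rw [← hi] at k1
  calc ρ ^ (1 + δ) ≤ ρ ^ (1 + 2 / 2 ^ j : ℝ) :=
        Real.rpow_le_rpow_of_exponent_ge hρ hρ1 (by linarith)
    _ = ρ * ρ ^ (2 / 2 ^ j : ℝ) := by rw [Real.rpow_add hρ, Real.rpow_one]
    _ ≤ prox G α ⟨v, hv⟩ (e i) * prox G α (e i) ⟨A (t i), h.lt _ (ht i)⟩ :=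
        mul_le_mul k1 (hqρ.trans k2) (by positivity) (prox_nonneg h0.le h1 _ _)
    _ ≤ _ := (prox_mul_prox_le h0.le h1 _ _ _).trans k3

/-- The edge set that the output represents. -/
theorem exists_represents (h0 : 0 < α) (h1 : α ≤ 1) {m : ℕ} {bq : ℝ} {s : State}
    (hn : 0 < n) (hbq : 0 < bq) (h : Best (graphOracle G α) n m bq s) :
    ∃ F : Finset (Sym2 (Fin n)), Represents s F ∧ (F : Set (Sym2 (Fin n))) ⊆ Gᶜ.edgeSet ∧
      F.card ≤ m - 1 ∧ bq ^ 2 * α ^ 2 ≤ broadcast (addEdges G F) α := by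
  rcases h with ⟨h, -⟩ | ⟨B, hB, hcov, hstar⟩
  · exact absurd h hbq.ne'
  have : Nonempty (Fin n) := ⟨⟨0, hn⟩⟩
  obtain ⟨i₀, hi₀, -⟩ := hcov 0 hn
  have hB0 : B 0 < n := hB 0 (by omega)
  have l0 : ∀ i : Fin (s.nvar 0), s.narr 0 i < n := fun i => by rw [hstar.fst_eq i i.2]; exact hB0
  have l1 : ∀ i : Fin (s.nvar 0), s.narr 1 i < n := fun i => by
    obtain ⟨i', hi', h, -⟩ := hstar.snd_eq i i.2
    rw [h]
    exact hB i' hi'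
  refine ⟨_, ⟨fun i => (⟨s.narr 0 i, l0 i⟩, ⟨s.narr 1 i, l1 i⟩), fun i => ⟨rfl, rfl⟩, rfl⟩, ?_, ?_, ?_⟩
  · intro e he
    simp only [Finset.coe_image, Finset.coe_univ, Set.image_univ, Set.mem_range] at he
    obtain ⟨i, rfl⟩ := he
    obtain ⟨i', hi', e1, hne, hadj⟩ := hstar.snd_eq i i.2
    have e0 := hstar.fst_eq i i.2
    rw [graphOracle_adj_eq_zero hB0 (hB i' hi')] at hadj
    rw [SimpleGraph.mem_edgeSet, SimpleGraph.compl_adj]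
    simp only [e0, e1, ne_eq, Fin.mk.injEq]
    exact ⟨hne.symm, hadj⟩
  · exact (Finset.card_image_le.trans (by simp)).trans hstar.len_le
  · refine le_broadcast_of_star h0.le h1 hbq.le (le_addEdges G _) ⟨B 0, hB0⟩ fun u => ?_
    obtain ⟨i, hi, hle⟩ := hcov u u.2
    rw [graphOracle_prox u.2 (hB i hi)] at hle
    refine ⟨⟨B i, hB i hi⟩, hle, ?_⟩
    by_cases hne : B i = B 0
    · left
      simp only [hne]
    · right
      by_cases hadj : G.Adj ⟨B 0, hB0⟩ ⟨B i, hB i hi⟩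
      · exact le_addEdges G _ hadj
      · obtain ⟨l, hl, hl'⟩ := hstar.mem i hi hne ((graphOracle_adj_eq_zero hB0 (hB i hi)).2 hadj)
        rw [addEdges, SimpleGraph.sup_adj, SimpleGraph.fromEdgeSet_adj]
        right
        refine ⟨?_, by simp only [ne_eq, Fin.mk.injEq]; exact fun h => hne h.symm⟩
        simp only [Finset.coe_image, Finset.coe_univ, Set.image_univ, Set.mem_range]
        refine ⟨⟨l, hl⟩, ?_⟩
        simp only [hstar.fst_eq l hl, hl']

end

/-! ### Running time. -/

/-- The number of steps of the main part. -/
theorem coreTime_le {n w m j N : ℕ} (hn : 1 ≤ n) (hw : 1 ≤ w) (hm : 2 ≤ m) (hN : m ≤ N) :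
    coreTime n w m j N + 12 ≤ 160 * (N ^ m * m * (n * w) * (j + 1)) := by
  -- Building the net takes time quadratic in `N`; for `m ≥ 2` the search over tuples dominates it.
  have hN2 : N * N ≤ N ^ m := by
    rw [← sq]; exact Nat.pow_le_pow_right (by omega) hm
  have cov : ∀ L, 1 ≤ L → covTime n w L ≤ 20 * (n * w) * L := by
    intro L hL
    unfold covTime
    have a1 : n * L ≤ n * w * L := Nat.mul_le_mul_right _ (Nat.le_mul_of_pos_right _ hw)
    have a2 : n ≤ n * w * L := (Nat.le_mul_of_pos_right _ hL).trans a1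
    have : n * (L * (w + 5) + 10) = n * w * L + 5 * (n * L) + 10 * n := by ring
    rw [this]
    linarith [hn.trans a2]
  have c1 := cov m (by omega)
  have c2 := cov N (by omega)
  unfold coreTime
  set x := n * w with hx
  have hx1 : 1 ≤ x := Nat.mul_pos hn hw
  set J := j + 1 with hJ
  set M := N ^ m with hM
  have hj : 3 * j ≤ 3 * J := by omega
  have hJ1 : 1 ≤ J := by omega
  have hNM : N ≤ M := (Nat.le_mul_of_pos_left N (by omega)).trans hN2
  have hM1 : 1 ≤ M := by omega
  set K := M * m * x * J with hK
  have b1 : M * (x * m) ≤ K := by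
    calc M * (x * m) = M * m * x := by ring
      _ ≤ K := Nat.le_mul_of_pos_right _ hJ1
  have b2 : M * m ≤ K := le_trans (Nat.mul_le_mul_left _ (Nat.le_mul_of_pos_left _ hx1)) b1
  have b3 : M ≤ K := le_trans (Nat.le_mul_of_pos_right _ (by omega)) b2
  have b4 : M * J ≤ K := by
    calc M * J = M * 1 * 1 * J := by ring
      _ ≤ K := by rw [hK]; gcongr; omega
  have b5 : J ≤ K := le_trans (Nat.le_mul_of_pos_left _ hM1) b4
  have b6 : x * m ≤ K := le_trans (Nat.le_mul_of_pos_left _ hM1) b1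
  have b7 : N * N * x ≤ K := by
    calc N * N * x ≤ M * x := Nat.mul_le_mul_right _ hN2
      _ ≤ M * (x * m) := Nat.mul_le_mul_left _ (Nat.le_mul_of_pos_right _ (by omega))
      _ ≤ K := b1
  have b8 : m * m * x ≤ K := le_trans (Nat.mul_le_mul_right _ (Nat.mul_le_mul hN hN)) b7
  have b9 : N * J ≤ K := le_trans (Nat.mul_le_mul_right _ hNM) b4
  have b10 : m ≤ K := (Nat.le_mul_of_pos_left _ hx1).trans b6
  have t1 : m * (covTime n w m + 3) ≤ 20 * K + 3 * K := by
    calc m * (covTime n w m + 3) ≤ m * (20 * x * m + 3) := by gcongr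
      _ = 20 * (m * m * x) + 3 * m := by ring
      _ ≤ _ := by omega
  have t2 : N * (covTime n w N + 3 * j + 6) ≤ 20 * K + 9 * K := by
    calc N * (covTime n w N + 3 * j + 6) ≤ N * (20 * x * N + 3 * J + 6) := by gcongr
      _ = 20 * (N * N * x) + 3 * (N * J) + 6 * N := by ring
      _ ≤ _ := by omega
  have t3 : M * (covTime n w m + 25 * m + 14) ≤ 20 * K + 25 * K + 14 * K := by
    calc M * (covTime n w m + 25 * m + 14) ≤ M * (20 * x * m + 25 * m + 14) := by gcongr
      _ = 20 * (M * (x * m)) + 25 * (M * m) + 14 * M := by ring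
      _ ≤ _ := by omega
  have t4 : covTime n w m ≤ 20 * K := by
    calc covTime n w m ≤ 20 * (x * m) := by rw [← mul_assoc]; exact c1
      _ ≤ _ := by omega
  omega

end InfoGraph
namespace InfoGraph
open RealRAM

/-- The upper bound keeps `2 ^ j` of order `1 / ε`, which the time bound needs. -/
theorem exists_first_power {x : ℝ} (hx : 1 < x) :
    ∃ j : ℕ, x ≤ 2 ^ j ∧ (∀ i < j, (2 : ℝ) ^ i < x) ∧ (2 : ℝ) ^ j ≤ 2 * x := by
  classical
  have hex : ∃ j : ℕ, x ≤ 2 ^ j := by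
    obtain ⟨j, hj⟩ := pow_unbounded_of_one_lt x (by norm_num : (1 : ℝ) < 2)
    exact ⟨j, hj.le⟩
  have hlt : ∀ i < Nat.find hex, (2 : ℝ) ^ i < x := fun i hi => not_le.1 (Nat.find_min hex hi)
  refine ⟨Nat.find hex, Nat.find_spec hex, hlt, ?_⟩
  rcases h : Nat.find hex with _ | j
  · rw [pow_zero]; linarith
  · have := hlt j (by omega)
    rw [pow_succ]
    linarith

theorem ten_le_timeBound {q n k : ℕ} {ε d : ℝ} (hn : 1 ≤ n) (hε : 0 < ε) (hd : 0 ≤ d) :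
    (10 : ℝ) ≤ timeBound (160 + q) n k ε d := by
  unfold timeBound
  have h1 : (1 : ℝ) ≤ (4 : ℝ) ^ k * (k : ℝ) ^ (2 * k) := by
    rcases Nat.eq_zero_or_pos k with rfl | hk
    · simp
    · have : (1 : ℝ) ≤ k := by exact_mod_cast hk
      exact one_le_mul_of_one_le_of_one_le (one_le_pow₀ (by norm_num)) (one_le_pow₀ this)
  have hx : (0 : ℝ) ≤ ((160 + q : ℕ) : ℝ) * k * d := by positivity
  have h2 : (1 : ℝ) ≤ 2 ^ (((160 + q : ℕ) : ℝ) * k * d) := Real.one_le_rpow (by norm_num) hx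
  have hm : 0 < min ε 1 := lt_min hε one_pos
  have h3 : (min ε 1) ^ (((160 + q : ℕ) : ℝ) * k * d) ≤ 1 :=
    Real.rpow_le_one hm.le (min_le_right _ _) hx
  have h4 : (10 : ℝ) ≤ ((160 + q : ℕ) : ℝ) * (n : ℝ) ^ (160 + q) := by
    have hn' : (1 : ℝ) ≤ n := by exact_mod_cast hn
    have := one_le_pow₀ hn' (n := 160 + q)
    push_cast
    have hq : (0 : ℝ) ≤ q := Nat.cast_nonneg q
    nlinarith
  have h5 : (1 : ℝ) ≤ (4 : ℝ) ^ k * (k : ℝ) ^ (2 * k) * 2 ^ (((160 + q : ℕ) : ℝ) * k * d) /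
      (min ε 1) ^ (((160 + q : ℕ) : ℝ) * k * d) := by
    rw [le_div_iff₀ (by positivity), one_mul]
    exact h3.trans (one_le_mul_of_one_le_of_one_le h1 h2)
  calc (10 : ℝ) = 1 * 10 := by norm_num
    _ ≤ _ := mul_le_mul h5 h4 (by norm_num) (by positivity)

/-- The number of steps is within the bound. -/
theorem coreTime_le_timeBound {q n k m j N : ℕ} {ε d : ℝ} (hn : 1 ≤ n) (hk : 1 ≤ k) (hm : 2 ≤ m)
    (hmk : m ≤ 2 * k) (hε : 0 < ε) (hd : 1 ≤ d) (hj : (2 : ℝ) ^ j ≤ 2 * (4 / ε + 32))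
    (hmN : m ≤ N) (hN : (N : ℝ) ≤ m * ((2 : ℝ) ^ d) ^ (j + 1)) :
    ((coreTime n (n ^ q) m j N + 12 : ℕ) : ℝ) ≤ timeBound (160 + q) n k ε d := by
  have hcore := coreTime_le (j := j) hn (Nat.one_le_pow q n hn) hm hmN
  set δ := min ε 1 with hδ
  have hδ0 : 0 < δ := lt_min hε one_pos
  have hδ1 : δ ≤ 1 := min_le_right _ _
  -- `Y` dominates `2 ^ (j + 1)`, which is at most `16 / ε + 128 ≤ 144 / δ`.
  set Y : ℝ := 2 ^ 8 / δ with hY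
  have hY2 : 2 ≤ Y := by
    rw [hY, le_div_iff₀ hδ0]; linarith
  have hY1 : 1 ≤ Y := by linarith
  have hj' : (2 : ℝ) ^ (j + 1) ≤ Y := by
    have : 4 / ε ≤ 4 / δ := div_le_div_of_nonneg_left (by norm_num) hδ0 (min_le_left _ _)
    have h1 : 1 ≤ 1 / δ := by rw [le_div_iff₀ hδ0]; linarith
    have h4 : 4 / δ = 4 * (1 / δ) := by ring
    have hY' : Y = 2 ^ 8 * (1 / δ) := by rw [hY]; ring
    rw [pow_succ, hY']
    linarith
  have hk1 : (1 : ℝ) ≤ k := by exact_mod_cast hk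
  have hdk : 1 ≤ d * k := one_le_mul_of_one_le_of_one_le hd hk1
  have hYdk : Y ≤ Y ^ (d * k) := by
    conv_lhs => rw [← Real.rpow_one Y]
    exact Real.rpow_le_rpow_of_exponent_le hY1 hdk
  have hD : ((2 : ℝ) ^ d) ^ (j + 1) ≤ Y ^ d := by
    rw [← Real.rpow_natCast, ← Real.rpow_mul (by norm_num), mul_comm, Real.rpow_mul (by norm_num),
      Real.rpow_natCast]
    exact Real.rpow_le_rpow (by positivity) hj' (by linarith)
  have hmk' : (m : ℝ) ≤ 2 * k := by exact_mod_cast hmk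
  have b1 : (N : ℝ) ^ m ≤ (4 : ℝ) ^ k * (k : ℝ) ^ (2 * k) * Y ^ (d * k) * Y ^ (d * k) := by
    calc (N : ℝ) ^ m ≤ (2 * k * Y ^ d) ^ m := by
          refine pow_le_pow_left₀ (Nat.cast_nonneg N) (hN.trans ?_) m
          exact mul_le_mul hmk' hD (by positivity) (by positivity)
      _ ≤ (2 * k * Y ^ d) ^ (2 * k) := by
          refine pow_le_pow_right₀ ?_ hmk
          exact one_le_mul_of_one_le_of_one_le (by linarith) (Real.one_le_rpow hY1 (by linarith))
      _ = _ := by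
          rw [mul_pow, mul_pow, pow_mul 2 2 k, two_mul k, pow_add (Y ^ d), Real.rpow_mul (by linarith),
            Real.rpow_natCast]
          norm_num
          ring
  have b2 : (m : ℝ) ≤ Y ^ (d * k) := by
    calc (m : ℝ) ≤ 2 * k := hmk'
      _ ≤ Y ^ k := by
          have := one_add_mul_le_pow (a := Y - 1) (by linarith) k
          have e : 1 + (Y - 1) = Y := by ring
          rw [e] at this
          have : (3 : ℝ) ≤ Y := by rw [hY, le_div_iff₀ hδ0]; linarith
          nlinarith
      _ ≤ Y ^ (d * k) := by
          rw [← Real.rpow_natCast]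
          exact Real.rpow_le_rpow_of_exponent_le hY1 (le_mul_of_one_le_left (by linarith) hd)
  have b3 : ((j : ℝ) + 1) ≤ Y ^ (d * k) := by
    have : ((j + 1 : ℕ) : ℝ) ≤ 2 ^ (j + 1) := by exact_mod_cast (Nat.lt_two_pow_self).le
    push_cast at this
    exact this.trans (hj'.trans hYdk)
  have hn1 : (1 : ℝ) ≤ n := by exact_mod_cast hn
  have b4 : (n : ℝ) * n ^ q ≤ n ^ (160 + q) := by
    rw [← pow_succ']
    exact pow_le_pow_right₀ hn1 (by omega)
  -- Two of the factors come from `N ^ m`, one from `m` and one from `j + 1`. Absorbing the last two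
  -- is what requires `1 ≤ d`.
  have hY4 : Y ^ (d * k) * Y ^ (d * k) * Y ^ (d * k) * Y ^ (d * k) ≤
      2 ^ (((160 + q : ℕ) : ℝ) * k * d) / δ ^ (((160 + q : ℕ) : ℝ) * k * d) := by
    have hY0 : 0 < Y := by linarith
    rw [← Real.rpow_add hY0, ← Real.rpow_add hY0, ← Real.rpow_add hY0, hY,
      Real.div_rpow (by positivity) hδ0.le, ← Real.rpow_natCast, ← Real.rpow_mul (by norm_num)]
    have hq : (0 : ℝ) ≤ q := Nat.cast_nonneg q
    have hqdk : 0 ≤ (q : ℝ) * (d * k) := by positivity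
    refine div_le_div₀ (by positivity) ?_ (by positivity) ?_
    · refine Real.rpow_le_rpow_of_exponent_le (by norm_num) ?_
      push_cast
      linarith
    · refine Real.rpow_le_rpow_of_exponent_ge hδ0 hδ1 ?_
      push_cast
      linarith
  have hcast : ((coreTime n (n ^ q) m j N + 12 : ℕ) : ℝ) ≤
      160 * ((N : ℝ) ^ m * m * (n * n ^ q) * (j + 1)) := by exact_mod_cast hcore
  refine hcast.trans ?_
  unfold timeBound
  rw [← hδ]
  set Z := Y ^ (d * k) with hZ
  have hZ0 : 0 ≤ Z := by positivity
  set P : ℝ := (4 : ℝ) ^ k * (k : ℝ) ^ (2 * k) with hP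
  have hP0 : 0 ≤ P := by positivity
  calc (160 : ℝ) * ((N : ℝ) ^ m * m * (n * n ^ q) * (j + 1))
      ≤ 160 * ((P * Z * Z) * Z * n ^ (160 + q) * Z) := by gcongr
    _ = P * (Z * Z * Z * Z) * (160 * n ^ (160 + q)) := by ring
    _ ≤ P * (2 ^ (((160 + q : ℕ) : ℝ) * k * d) / δ ^ (((160 + q : ℕ) : ℝ) * k * d)) *
        (((160 + q : ℕ) : ℝ) * n ^ (160 + q)) := by
          gcongr
          push_cast
          linarith [(Nat.cast_nonneg q : (0 : ℝ) ≤ q)]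
    _ = _ := by ring

section
variable {n k : ℕ} {G : SimpleGraph (Fin n)} {α ε : ℝ}

theorem impliedDist_pos (hG : G.Connected) (h0 : 0 < α) (h1 : α < 1) (u v : Fin n) (huv : u ≠ v) :
    0 < impliedDist G α u v := by
  unfold impliedDist
  have := Real.logb_neg (b := 2) (by norm_num) (prox_pos hG h0 h1.le u v)
    (prox_lt_one h0.le h1 huv)
  linarith

/-- In each of these cases `G` itself is optimal. They are split off because for `n < 2` or `α = 1`
the lower bound `1` on the doubling dimension fails, and for `k = 0` there is nothing to search. -/
theorem exists_output_of_trivial (i : Instr) (q : ℕ) (hG : G.Connected) (h0 : 0 < α) (h1 : α ≤ 1) (hε : 0 < ε)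
    (h : k = 0 ∨ n < 2 ∨ ¬ α < 1) :
    ∃ (F : Finset (Sym2 (Fin n))) (t : ℕ), Computes (main i) q G α k ε F t ∧
      (t : ℝ) ≤ timeBound (160 + q) n k ε (doublingDim (impliedDist G α)) ∧
      (F : Set (Sym2 (Fin n))) ⊆ Gᶜ.edgeSet ∧ F.card = 0 ∧
      optBroadcast G α k ≤ broadcast (addEdges G F) α := by
  have := hG.nonempty
  have hn : 1 ≤ n := Fin.pos_iff_nonempty.2 this
  obtain ⟨s, t, hex, ht, hs⟩ := runs_main_trivial (O := graphOracle G α) (w := n ^ q) (ε := ε) i h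
  refine ⟨∅, t, ⟨s, hex, ?_⟩, ?_, by simp, by simp, ?_⟩
  · have he : IsEmpty (Fin (s.nvar 0)) := by rw [hs]; exact Fin.isEmpty
    exact ⟨fun i => he.elim i, fun i => he.elim i, by simp⟩
  · have : (t : ℝ) ≤ 10 := by exact_mod_cast ht
    exact this.trans (ten_le_timeBound hn hε (doublingDim_nonneg (impliedDist_self G α)))
  · rw [addEdges_empty]
    rcases h with rfl | h | h
    · rw [optBroadcast_zero]
    · refine (optBroadcast_le_one h0.le h1 k).trans (le_broadcast fun u v => ?_)
      have : u = v := Fin.ext (by omega)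
      rw [this, prox_self]
    · obtain rfl : α = 1 := le_antisymm h1 (not_lt.1 h)
      exact (optBroadcast_le_one h0.le h1 k).trans (le_broadcast fun u v => (prox_eq_one u v hG).ge)

/-- The common core of both algorithms: any existence result for `m` centres of coverage `ρ` becomes
a guarantee for the program. -/
theorem exists_output_of_centres {m z : ℕ} (q : ℕ) (hz : z = 1 ∧ m = k + k ∨ z = 4 ∧ m = k + 1)
    (hG : G.Connected) (h0 : 0 < α) (h1 : α < 1) (hn : 2 ≤ n) (hk : 0 < k) (hε : 0 < ε) {ρ δ : ℝ}
    {S : Finset (Fin n)} (hS : S.Nonempty) (hSm : S.card ≤ m) (hρ : 0 < ρ) (hρ1 : ρ ≤ 1)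
    (hcover : ∀ u, ∃ s ∈ S, ρ ≤ prox G α u s) (hδ : min (ε / 2) (1 / 16) ≤ δ) :
    ∃ (F : Finset (Sym2 (Fin n))) (t : ℕ), Computes (main (.nadd 3 1 z)) q G α k ε F t ∧
      (t : ℝ) ≤ timeBound (160 + q) n k ε (doublingDim (impliedDist G α)) ∧
      (F : Set (Sym2 (Fin n))) ⊆ Gᶜ.edgeSet ∧ F.card ≤ m - 1 ∧
      (ρ ^ (1 + δ)) ^ 2 * α ^ 2 ≤ broadcast (addEdges G F) α := by
  have hm : 2 ≤ m := by omega
  have hmk : m ≤ 2 * k := by omega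
  have hnt : Nontrivial (Fin n) := Fin.nontrivial_iff_two_le.2 hn
  have hd := one_le_doublingDim (impliedDist_self G α) (impliedDist_pos hG h0 h1)
  have h4 : 0 < 4 / ε := by positivity
  obtain ⟨j, hj, hj', hj2⟩ := exists_first_power (x := 4 / ε + 32) (by linarith)
  set d := doublingDim (impliedDist G α)
  have hX : (1 : ℝ) ≤ (2 : ℝ) ^ d := Real.one_le_rpow (by norm_num) (by linarith)
  obtain ⟨s, t, hex, ht, A, N, qm, bq, hnet, hcov, hbq, hbest⟩ := runs_main (w := n ^ q)
    (graphOracle_bounded G h0.le h1.le) (NB := ⌊(m : ℝ) * ((2 : ℝ) ^ d) ^ (j + 1)⌋₊) z hz hn hk h1 hj hj'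
    fun A N qm h => Nat.le_floor (IsNet.card_le hG h0 h1.le (by omega) h)
  -- The threshold `4 / ε + 32` is chosen for this: its summands give the bounds `ε / 2` and `1 /
  -- 16`.
  have hδ' : 2 / 2 ^ j ≤ δ := by
    refine le_trans (le_min ?_ ?_) hδ
    · rw [div_le_div_iff₀ (by positivity) (by norm_num)]
      have : 4 ≤ 2 ^ j * ε := by
        have := mul_le_mul_of_nonneg_right hj hε.le
        have e : (4 / ε + 32) * ε = 4 + 32 * ε := by field_simp
        rw [e] at this
        linarith
      linarith
    · rw [div_le_div_iff₀ (by positivity) (by norm_num)]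
      linarith
  have hle := rpow_le_of_isNet h0 h1.le (by omega) hnet hcov hbq hS hSm hρ hρ1 hcover hδ'
  have hpos : 0 < ρ ^ (1 + δ) := Real.rpow_pos_of_pos hρ _
  obtain ⟨F, hF, hFG, hFm, hb⟩ := exists_represents h0 h1.le (by omega) (hpos.trans_le hle) hbest
  refine ⟨F, t, ⟨s, hex, hF⟩, ?_, hFG, hFm, le_trans ?_ hb⟩
  · have hcast : (t : ℝ) ≤ ((coreTime n (n ^ q) m j ⌊(m : ℝ) * ((2 : ℝ) ^ d) ^ (j + 1)⌋₊ + 12 : ℕ) : ℝ) :=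
      by exact_mod_cast ht
    refine hcast.trans (coreTime_le_timeBound (by omega) hk hm hmk hε hd hj2 (Nat.le_floor ?_)
      (Nat.floor_le (by positivity)))
    exact le_mul_of_one_le_right (Nat.cast_nonneg _) (one_le_pow₀ hX)
  · gcongr

end

/-- The ninth and eighth powers encode the exponent `9 / 8`, which leaves room above `1 + 1 / 16`.
From `k = 7` on, `(k + 2) / (k + 1) ≤ 9 / 8`, and `3 ^ 9 * (9 / 8) ^ 9 ≤ 4 ^ 8` carries the
induction. -/
theorem centres_const_le (k : ℕ) : (3 ^ k * (k + 1)) ^ 9 ≤ (4 ^ (k + 1)) ^ 8 := by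
  rcases lt_or_ge k 7 with hk | hk
  · interval_cases k <;> norm_num
  · induction k, hk using Nat.le_induction with
    | base => norm_num
    | succ k hk ih =>
      have h := Nat.pow_le_pow_left (show 8 * (k + 2) ≤ 9 * (k + 1) by omega) 9
      calc (3 ^ (k + 1) * (k + 1 + 1)) ^ 9 = (3 ^ k) ^ 9 * (19683 * (k + 2) ^ 9) := by ring
        _ ≤ (3 ^ k) ^ 9 * (65536 * (k + 1) ^ 9) := by
            refine Nat.mul_le_mul_left _ ?_
            rw [mul_pow, mul_pow] at h
            norm_num at h
            generalize (k + 2) ^ 9 = a at h ⊢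
            generalize (k + 1) ^ 9 = b at h ⊢
            omega
        _ = 65536 * (3 ^ k * (k + 1)) ^ 9 := by ring
        _ ≤ 65536 * (4 ^ (k + 1)) ^ 8 := Nat.mul_le_mul_left _ ih
        _ = (4 ^ (k + 1 + 1)) ^ 8 := by ring

theorem rpow_centres_const_le (k : ℕ) {δ : ℝ} (hδ : δ ≤ 1 / 16) :
    ((3 : ℝ) ^ k * (k + 1)) ^ (1 + δ) ≤ 4 ^ (k + 1) := by
  have h1 : (1 : ℝ) ≤ 3 ^ k * (k + 1) :=
    one_le_mul_of_one_le_of_one_le (one_le_pow₀ (by norm_num)) (by linarith [(Nat.cast_nonneg k : (0 : ℝ) ≤ k)])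
  refine (Real.rpow_le_rpow_of_exponent_le h1 (show 1 + δ ≤ 9 / 8 by linarith)).trans ?_
  rw [← pow_le_pow_iff_left₀ (by positivity) (by positivity) (show 8 ≠ 0 by norm_num),
    ← Real.rpow_natCast _ 8, ← Real.rpow_mul (by positivity)]
  have e : (9 / 8 : ℝ) * ((8 : ℕ) : ℝ) = ((9 : ℕ) : ℝ) := by norm_num
  rw [e, Real.rpow_natCast]
  exact_mod_cast centres_const_le k

theorem rpow_sq {x ε : ℝ} (hx : 0 < x) : (x ^ (1 + ε / 2)) ^ 2 = x ^ (2 + ε) := by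
  rw [← Real.rpow_natCast, ← Real.rpow_mul hx.le]
  congr 1
  push_cast
  ring

/-- The guarantee holds if the broadcast of the output is optimal. -/
theorem guarantee_of_le {b β α ε c : ℝ} (hβ : 0 < β) (hβ1 : β ≤ 1) (h0 : 0 < α) (h1 : α ≤ 1)
    (hε : 0 < ε) (hc : 1 ≤ c) (h : β ≤ b) : β ^ (2 + ε) * α ^ 2 / c ≤ b := by
  have e1 : β ^ (2 + ε) ≤ β := by
    conv_rhs => rw [← Real.rpow_one β]
    exact Real.rpow_le_rpow_of_exponent_ge hβ hβ1 (by linarith)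
  have e2 : α ^ 2 ≤ 1 := pow_le_one₀ h0.le h1
  rw [div_le_iff₀ (by linarith)]
  calc β ^ (2 + ε) * α ^ 2 ≤ β * 1 := by gcongr
    _ ≤ b * c := mul_le_mul h hc zero_le_one (hβ.le.trans h)

end InfoGraph

theorem mainTheorem8 :
    (∃ P : RealRAM.Prog, ∀ q : ℕ, ∃ C : ℕ,
      ∀ (n k : ℕ) (G : SimpleGraph (Fin n)) (α ε : ℝ),
        G.Connected → 0 < α → α ≤ 1 → 0 < ε →
        ∃ (F : Finset (Sym2 (Fin n))) (t : ℕ),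
          RealRAM.Computes P q G α k ε F t ∧
          (t : ℝ) ≤ timeBound C n k ε (InfoGraph.doublingDim (InfoGraph.impliedDist G α)) ∧
          (F : Set (Sym2 (Fin n))) ⊆ Gᶜ.edgeSet ∧
          F.card ≤ 2 * k - 1 ∧
          InfoGraph.optBroadcast G α k ^ (2 + ε) * α ^ 2 / (1 + 2 * k * α) ^ (2 + ε) ≤
            InfoGraph.broadcast (InfoGraph.addEdges G F) α) ∧
    (∃ P : RealRAM.Prog, ∀ q : ℕ, ∃ C : ℕ,
      ∀ (n k : ℕ) (G : SimpleGraph (Fin n)) (α ε : ℝ),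
        G.Connected → 0 < α → α ≤ 1 → 0 < ε →
        ∃ (F : Finset (Sym2 (Fin n))) (t : ℕ),
          RealRAM.Computes P q G α k ε F t ∧
          (t : ℝ) ≤ timeBound C n k ε (InfoGraph.doublingDim (InfoGraph.impliedDist G α)) ∧
          (F : Set (Sym2 (Fin n))) ⊆ Gᶜ.edgeSet ∧
          F.card ≤ k ∧
          InfoGraph.optBroadcast G α k ^ (2 + ε) * α ^ 2 / 16 ^ (k + 1) ≤
            InfoGraph.broadcast (InfoGraph.addEdges G F) α) := by
  refine ⟨⟨RealRAM.main (.nadd 3 1 1), fun q => ⟨160 + q, ?_⟩⟩,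
    ⟨RealRAM.main (.nadd 3 1 4), fun q => ⟨160 + q, ?_⟩⟩⟩
  · intro n k G α ε hG h0 h1 hε
    have := hG.nonempty
    have hβ := InfoGraph.optBroadcast_pos hG h0 h1 k
    have hβ1 := InfoGraph.optBroadcast_le_one (G := G) h0.le h1 k
    have hc : 1 ≤ 1 + 2 * k * α := by
      have : 0 ≤ 2 * k * α := by positivity
      linarith
    by_cases htriv : k = 0 ∨ n < 2 ∨ ¬ α < 1
    · obtain ⟨F, t, hP, ht, hF, hFc, hb⟩ :=
        InfoGraph.exists_output_of_trivial (.nadd 3 1 1) q hG h0 h1 hε htriv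
      exact ⟨F, t, hP, ht, hF, by omega, InfoGraph.guarantee_of_le hβ hβ1 h0 h1 hε
        (Real.one_le_rpow hc (by linarith)) hb⟩
    · push Not at htriv
      obtain ⟨hk, hn, hα⟩ := htriv
      obtain ⟨S, hS, hSc, hcover⟩ := InfoGraph.exists_centres_two_mul (G := G) h0.le h1
        (Nat.pos_of_ne_zero hk)
      obtain ⟨F, t, hP, ht, hF, hFc, hb⟩ := InfoGraph.exists_output_of_centres (m := k + k) (z := 1) (δ := ε / 2)
        q (Or.inl ⟨rfl, rfl⟩) hG h0 hα hn (Nat.pos_of_ne_zero hk) hε hS (by omega)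
        (div_pos hβ (by linarith)) ((div_le_one (by linarith)).2 (hβ1.trans hc)) hcover (min_le_left _ _)
      refine ⟨F, t, hP, ht, hF, by omega, le_trans (le_of_eq ?_) hb⟩
      rw [InfoGraph.rpow_sq (div_pos hβ (by linarith)), Real.div_rpow hβ.le (by linarith)]
      ring
  · intro n k G α ε hG h0 h1 hε
    have := hG.nonempty
    have hβ := InfoGraph.optBroadcast_pos hG h0 h1 k
    have hβ1 := InfoGraph.optBroadcast_le_one (G := G) h0.le h1 k
    by_cases htriv : k = 0 ∨ n < 2 ∨ ¬ α < 1
    · obtain ⟨F, t, hP, ht, hF, hFc, hb⟩ :=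
        InfoGraph.exists_output_of_trivial (.nadd 3 1 4) q hG h0 h1 hε htriv
      exact ⟨F, t, hP, ht, hF, by omega, InfoGraph.guarantee_of_le hβ hβ1 h0 h1 hε
        (one_le_pow₀ (by norm_num)) hb⟩
    · push Not at htriv
      obtain ⟨hk, hn, hα⟩ := htriv
      obtain ⟨S, hS, hSc, hcover⟩ := InfoGraph.exists_centres_succ (G := G) h0.le h1 k
      have hc : (1 : ℝ) ≤ 3 ^ k * (k + 1) := one_le_mul_of_one_le_of_one_le
        (one_le_pow₀ (by norm_num)) (by linarith [(Nat.cast_nonneg k : (0 : ℝ) ≤ k)])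
      set δ := min (ε / 2) (1 / 16) with hδ
      obtain ⟨F, t, hP, ht, hF, hFc, hb⟩ := InfoGraph.exists_output_of_centres (m := k + 1) (z := 4) (δ := δ)
        q (Or.inr ⟨rfl, rfl⟩) hG h0 hα hn (Nat.pos_of_ne_zero hk) hε hS hSc
        (div_pos hβ (by linarith)) ((div_le_one (by linarith)).2 (hβ1.trans hc)) hcover le_rfl
      refine ⟨F, t, hP, ht, hF, by omega, le_trans ?_ hb⟩
      -- Capping `δ` at `1 / 16` keeps the constant below `4 ^ (k + 1)`, whose square is `16 ^ (k +
      -- 1)`; shrinking the exponent of `β* ≤ 1` only helps.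
      have key : InfoGraph.optBroadcast G α k ^ (1 + ε / 2) / 4 ^ (k + 1) ≤
          (InfoGraph.optBroadcast G α k / (3 ^ k * (k + 1))) ^ (1 + δ) := by
        rw [Real.div_rpow hβ.le (by linarith)]
        refine div_le_div₀ (by positivity) ?_ (by positivity)
          (InfoGraph.rpow_centres_const_le k (min_le_right _ _))
        exact Real.rpow_le_rpow_of_exponent_ge hβ hβ1 (by linarith [min_le_left (ε / 2) (1 / 16)])
      calc InfoGraph.optBroadcast G α k ^ (2 + ε) * α ^ 2 / 16 ^ (k + 1)
          = (InfoGraph.optBroadcast G α k ^ (1 + ε / 2) / 4 ^ (k + 1)) ^ 2 * α ^ 2 := by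
            rw [div_pow, InfoGraph.rpow_sq hβ, ← pow_mul, mul_comm (k + 1) 2, pow_mul]
            norm_num
            ring
        _ ≤ _ := by gcongr
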